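/- **Tableaux.** A tableau is a semistandard Young tableau with integer entries (rows weakly increasing, columns strictly increasing); the product $P\cdot Q$ is obtained by row-inserting the entries of $Q$ into $P$, reading the rows of $Q$ from bottom to top and each row from left to right. Let $(b)^a$ denote the rectangle with $a\ge 0$ rows and $b\ge 0$ columns. If the shape of $W$ contains $(b)^a$, let $T$ be the part of $W$ in this rectangle (the first $a$ rows and first $b$ columns), $Q_0$ the part of $W$ below $T$ (rows $>a$, columns $\le b$), $P_0$ the part to the right of $T$ (rows $\le a$, columns $>b$) and $Z$ the remaining part (rows $>a$, columns $>b$). A *simple factorization* of $W$ with respect to $(b)^a$ is a factorization $W=Q\cdot T\cdot P$ such that $Q=Q_0\cdot\tilde Q$ and $P=\tilde P\cdot P_0$ for some factorization $Z=\tilde Q\cdot\tilde P$. Let $T$ be a tableau of shape $(b)^a$. For tableaux $X,Y$ all of whose entries are strictly larger than the entries of $T$, let $X_0$ be the first $b$ columns of $X$ and $\tilde X$ the rest of $X$, and let $Y_0$ be the first $a$ rows of $Y$ and $\tilde Y$ the rest of $Y$. Write $(X,Y)\models(X',Y')$ if either $X'=X_0\cdot M$ and $Y'=N\cdot Y$ for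 some factorization $\tilde X=M\cdot N$, or $X'=X\cdot M$ and $Y'=N\cdot Y_0$ for some factorization $\tilde Y=M\cdot N$. Let $\to$ be the transitive closure of $\models$ (it depends on $T$, $a$ and $b$). **Diagrams.** Let $n\ge 0$. A *rectangle diagram* consists of rectangles $R_{ij}$ for $0\le i<j\le n$, where $R_{ij}$ has $a_{ij}\ge 0$ rows and $b_{ij}\ge 0$ columns, such that $a_{i,j+1}\le a_{ij}$ and $b_{ij}\le b_{i+1,j}$ whenever these are defined. (For instance, rank conditions $r_{ij}$, $0\le i\le j\le n$, that occur for a sequence of linear maps give such a diagram with $a_{ij}=r_{i+1,j}-r_{ij}$ and $b_{ij}=r_{i,j-1}-r_{ij}$.) A *tableau diagram* consists of tableaux $T_{ij}$ of shape $R_{ij}$ such that every entry of $T_{ij}$ is strictly larger than every entry of $T_{kl}$ whenever $i\le k<l\le j$ and $(k,l)\ne(i,j)$. **Paths.** A *path* is a sequence of steps from $(0,0)$ to $(n,n)$ through points $(i,j)$ with $0\le i\le j\le n$, each step being down, $(i,j)\mapsto(i,j+1)$, up, $(i,j)\mapsto(i+1,j)$, or horizontal, $(i,j)\mapsto(i+1,j+1)$.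 Paths $\gamma,\gamma'$ are related as in *Case 1* if $\gamma'$ is obtained from $\gamma$ by replacing an up step that is immediately followed by a down step by one horizontal step. They are related as in *Case 2*, at the triangle $(i,j)$, if $\gamma'$ is obtained from $\gamma$ by replacing a horizontal step from $(i,j-1)$ to $(i+1,j)$ by a down step to $(i,j)$ followed by an up step to $(i+1,j)$. **Factor sequences.** Fix a tableau diagram. A *factor sequence* for a path is a labeling of its steps by tableaux, defined inductively. For the lowest path ($n$ down steps, then $n$ up steps) the only factor sequence is $(\emptyset,\dots,\emptyset)$. If $\gamma,\gamma'$ are related as in Case 1, $(\dots,W,\dots)$ is a factor sequence for $\gamma'$ with $W$ the label of the horizontal step in question, and $W=P\cdot Q$ is any factorization, then $(\dots,P,Q,\dots)$ is a factor sequence for $\gamma$. If $\gamma,\gamma'$ are related as in Case 2 at $(i,j)$ and $(\dots,Q,P,\dots)$ is a factor sequence for $\gamma'$ with $Q,P$ the labels of the two steps in question, then $(\dots,Q\cdot T_{ij}\cdot P,\dots)$ is a factor sequence for $\gamma$. **Statement.** Let $\gamma$ and $\gamma'$ be paths related as in Case 2 at $(i,j)$, and put $T=T_{ij}$, $a=a_{ij}$,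 $b=b_{ij}$. 1. Let $(\dots,W,\dots)$ be a factor sequence for $\gamma$, where $W$ labels the horizontal step in which $\gamma$ differs from $\gamma'$. Then $W$ contains $T$ in its upper-left corner, and if $W=Q\cdot T\cdot P$ is any simple factorization of $W$ with respect to $(b)^a$, then $(\dots,Q,P,\dots)$ is a factor sequence for $\gamma'$. 2. Let $(\dots,X,Y,\dots)$ be a factor sequence for $\gamma'$, where $X,Y$ label the two steps in which $\gamma'$ differs from $\gamma$. If $(X,Y)\to(X',Y')$, then $(\dots,X',Y',\dots)$ is a factor sequence for $\gamma'$. -/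

import Mathlib

namespace FactorSeq

/-! ### Semistandard Young tableaux with integer entries -/

/-- `Above r s`: the row `s` can be placed directly below the row `r` (both left justified),
i.e. `s` is not longer than `r` and every entry of `s` is strictly larger than the entry of `r`
in the same column. -/
def Above : List ℤ → List ℤ → Prop
  | _, [] => True
  | [], _ :: _ => False
  | x :: r, y :: s => x < y ∧ Above r s

/-- A list of rows (top to bottom) forms a semistandard Young tableau. -/
structure IsTableau (rows : List (List ℤ)) : Prop where
  ne_nil : ∀ r ∈ rows, r ≠ []
  row_weak : ∀ r ∈ rows, r.Pairwise (· ≤ ·)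
  col_strict : rows.IsChain Above

/-- A (semistandard Young) tableau with integer entries, given by its nonempty rows from top to
bottom. -/
@[ext]
structure Tableau where
  rows : List (List ℤ)
  isTableau : IsTableau rows

theorem Above.trans : ∀ {r s t : List ℤ}, Above r s → Above s t → Above r t
  | _, _, [], _, _ => by simp [Above]
  | _, [], _ :: _, _, h => by simp [Above] at h
  | [], _ :: _, _ :: _, h, _ => by simp [Above] at h
  | _ :: _, _ :: _, _ :: _, h, h' => ⟨h.1.trans h'.1, h.2.trans h'.2⟩

theorem Above.take : ∀ {r s : List ℤ} (b : ℕ), Above r s → Above (r.take b) (s.take b)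
  | _, [], _, _ => by simp [Above]
  | [], _ :: _, _, h => by simp [Above] at h
  | _ :: _, _ :: _, 0, _ => by simp [Above]
  | _ :: _, _ :: _, b + 1, h => ⟨h.1, h.2.take b⟩

theorem Above.drop : ∀ {r s : List ℤ} (b : ℕ), Above r s → Above (r.drop b) (s.drop b)
  | _, [], _, _ => by simp [Above]
  | [], _ :: _, _, h => by simp [Above] at h
  | _ :: _, _ :: _, 0, h => by simpa using h
  | _ :: _, _ :: _, b + 1, h => by simpa using h.2.drop b

theorem IsTableau.pairwise {rows : List (List ℤ)} (h : IsTableau rows) : rows.Pairwise Above :=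
  haveI : Trans Above Above Above := ⟨Above.trans⟩
  List.isChain_iff_pairwise.1 h.col_strict

/-- Apply `f` (cutting off columns) to every row, and discard the rows that became empty. -/
theorem IsTableau.mapFilter {rows : List (List ℤ)} (h : IsTableau rows) (f : List ℤ → List ℤ)
    (hf : ∀ r s, Above r s → Above (f r) (f s)) (hs : ∀ r, (f r).Sublist r) :
    IsTableau ((rows.map f).filter (fun r => !r.isEmpty)) where
  ne_nil r hr := by
    rw [List.mem_filter] at hr
    simpa using hr.2
  row_weak r hr := by
    rw [List.mem_filter, List.mem_map] at hr
    obtain ⟨⟨s, hs', rfl⟩, -⟩ := hr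
    exact (h.row_weak s hs').sublist (hs s)
  col_strict :=
    ((List.pairwise_map.2 (h.pairwise.imp (hf _ _))).filter _).isChain

namespace Tableau

/-- The empty tableau. -/
instance : EmptyCollection Tableau := ⟨⟨[], ⟨by simp, by simp, by simp⟩⟩⟩

/-- The length of the `i`-th row (rows are numbered from `0`), `0` if there is no such row. -/
def rowLen (T : Tableau) (i : ℕ) : ℕ := (T.rows.getD i []).length

/-- The reading word: the rows from bottom to top, each from left to right. -/
def word (T : Tableau) : List ℤ := T.rows.reverse.flatten

/-- `x` is the entry of some box of `T`. -/
def HasEntry (T : Tableau) (x : ℤ) : Prop := ∃ r ∈ T.rows, x ∈ r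

/-- The first `a` rows. -/
def top (a : ℕ) (T : Tableau) : Tableau :=
  ⟨T.rows.take a, fun r hr => T.isTableau.ne_nil r (List.mem_of_mem_take hr),
    fun r hr => T.isTableau.row_weak r (List.mem_of_mem_take hr), T.isTableau.col_strict.take a⟩

/-- The part below the first `a` rows. -/
def below (a : ℕ) (T : Tableau) : Tableau :=
  ⟨T.rows.drop a, fun r hr => T.isTableau.ne_nil r (List.mem_of_mem_drop hr),
    fun r hr => T.isTableau.row_weak r (List.mem_of_mem_drop hr), T.isTableau.col_strict.drop a⟩

/-- The first `b` columns. -/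
def left (b : ℕ) (T : Tableau) : Tableau :=
  ⟨(T.rows.map (List.take b)).filter (fun r => !r.isEmpty),
    T.isTableau.mapFilter _ (fun _ _ h => h.take b) (List.take_sublist b)⟩

/-- The part to the right of the first `b` columns. -/
def right (b : ℕ) (T : Tableau) : Tableau :=
  ⟨(T.rows.map (List.drop b)).filter (fun r => !r.isEmpty),
    T.isTableau.mapFilter _ (fun _ _ h => h.drop b) (List.drop_sublist b)⟩

end Tableau

/-! ### Row bumping and the product of tableaux -/

/-- Row-insert `x` into a row: `x` replaces the leftmost entry that is strictly larger than `x`,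
which is bumped out; if there is none, `x` is put at the end of the row and nothing is bumped. -/
def bump (x : ℤ) : List ℤ → Option ℤ × List ℤ
  | [] => (none, [x])
  | y :: r => if x < y then (some y, x :: r) else ((bump x r).1, y :: (bump x r).2)

/-- Row-insert `x` into the first row, the entry bumped out into the second row, and so on. -/
def insertRows : List (List ℤ) → ℤ → List (List ℤ)
  | [], x => [[x]]
  | r :: rs, x =>
    match (bump x r).1 with
    | none => (bump x r).2 :: rs
    | some y => (bump x r).2 :: insertRows rs y

theorem bump_ne_nil (x : ℤ) (r : List ℤ) : (bump x r).2 ≠ [] := by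
  cases r with
  | nil => simp [bump]
  | cons y r => by_cases h : x < y <;> simp [bump, h]

theorem mem_bump {x z : ℤ} : ∀ {r : List ℤ}, z ∈ (bump x r).2 → z = x ∨ z ∈ r
  | [], h => by simpa [bump] using h
  | y :: r, h => by
    by_cases hxy : x < y
    · simp only [bump, hxy, if_true, List.mem_cons] at h ⊢
      tauto
    · simp only [bump, hxy, if_false, List.mem_cons] at h ⊢
      rcases h with h | h
      · tauto
      · have := mem_bump h
        tauto

theorem bump_sorted {x : ℤ} : ∀ {r : List ℤ}, r.Pairwise (· ≤ ·) →
    (bump x r).2.Pairwise (· ≤ ·)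
  | [], _ => by simp [bump]
  | y :: r, h => by
    rw [List.pairwise_cons] at h
    by_cases hxy : x < y
    · simp only [bump, hxy, if_true, List.pairwise_cons]
      exact ⟨fun z hz => hxy.le.trans (h.1 z hz), h.2⟩
    · simp only [bump, hxy, if_false, List.pairwise_cons]
      refine ⟨fun z hz => ?_, bump_sorted h.2⟩
      rcases mem_bump hz with rfl | hz
      · exact not_lt.1 hxy
      · exact h.1 z hz

theorem lt_of_bump {x y : ℤ} : ∀ {r : List ℤ}, (bump x r).1 = some y → x < y
  | [], h => by simp [bump] at h
  | z :: r, h => by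
    by_cases hxz : x < z
    · simp only [bump, hxz, if_true, Option.some.injEq] at h
      exact h ▸ hxz
    · simp only [bump, hxz, if_false] at h
      exact lt_of_bump h

theorem Above.bump {x : ℤ} : ∀ {r s : List ℤ}, Above r s → Above (bump x r).2 s
  | _, [], _ => by simp [Above]
  | [], _ :: _, h => by simp [Above] at h
  | y :: r, z :: s, h => by
    by_cases hxy : x < y
    · simp only [FactorSeq.bump, hxy, if_true]
      exact ⟨hxy.trans h.1, h.2⟩
    · simp only [FactorSeq.bump, hxy, if_false]
      exact ⟨h.1, h.2.bump⟩

theorem Above.bump_bump {x y : ℤ} : ∀ {r s : List ℤ}, Above r s →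
    (FactorSeq.bump x r).1 = some y →
    Above (FactorSeq.bump x r).2 (FactorSeq.bump y s).2
  | [], _, _, h => by simp [FactorSeq.bump] at h
  | u :: r, s, hrs, h => by
    by_cases hxu : x < u
    · simp only [FactorSeq.bump, hxu, if_true, Option.some.injEq] at h ⊢
      subst h
      cases s with
      | nil => simp [FactorSeq.bump, Above, hxu]
      | cons v s => simpa [FactorSeq.bump, Above, hrs.1, hxu] using hrs.2
    · simp only [FactorSeq.bump, hxu, if_false] at h ⊢
      have huy : u < y := (not_lt.1 hxu).trans_lt (lt_of_bump h)
      cases s with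
      | nil => simp [FactorSeq.bump, Above, huy]
      | cons v s =>
        by_cases hyv : y < v
        · simp only [FactorSeq.bump, hyv, if_true]
          exact ⟨huy, hrs.2.bump⟩
        · simp only [FactorSeq.bump, hyv, if_false]
          exact ⟨hrs.1, hrs.2.bump_bump h⟩

theorem IsTableau.tail {r : List ℤ} {rs : List (List ℤ)} (h : IsTableau (r :: rs)) :
    IsTableau rs :=
  ⟨fun s hs => h.ne_nil s (List.mem_cons_of_mem _ hs),
    fun s hs => h.row_weak s (List.mem_cons_of_mem _ hs), h.col_strict.tail⟩

theorem IsTableau.cons {r : List ℤ} {rs : List (List ℤ)} (h : IsTableau rs) (h0 : r ≠ [])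
    (h1 : r.Pairwise (· ≤ ·)) (h2 : ∀ s ∈ rs.head?, Above r s) : IsTableau (r :: rs) where
  ne_nil := by
    simpa [h0] using h.ne_nil
  row_weak := by
    simpa [h1] using h.row_weak
  col_strict := List.isChain_cons.2 ⟨h2, h.col_strict⟩

theorem IsTableau.insertRows : ∀ {rs : List (List ℤ)} (x : ℤ), IsTableau rs →
    IsTableau (insertRows rs x)
  | [], x, _ => ⟨by simp [FactorSeq.insertRows], by simp [FactorSeq.insertRows],
      by simp [FactorSeq.insertRows]⟩
  | r :: rs, x, h => by
    have hr := bump_sorted (x := x) (h.row_weak r (by simp))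
    have hc := (List.isChain_cons.1 h.col_strict).1
    cases hb : (bump x r).1 with
    | none =>
      simp only [FactorSeq.insertRows, hb]
      exact h.tail.cons (bump_ne_nil x r) hr fun s hs => (hc s hs).bump
    | some y =>
      simp only [FactorSeq.insertRows, hb]
      refine (h.tail.insertRows y).cons (bump_ne_nil x r) hr ?_
      intro s hs
      cases rs with
      | nil =>
        simp only [FactorSeq.insertRows, List.head?_cons, Option.mem_def,
          Option.some.injEq] at hs
        subst hs
        have : Above r [] := by simp [Above]
        simpa [bump] using this.bump_bump hb
      | cons t rs =>
        have ht : s = (bump y t).2 := by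
          cases hb' : (bump y t).1 <;>
            simp only [FactorSeq.insertRows, hb', List.head?_cons, Option.mem_def,
              Option.some.injEq] at hs <;> exact hs.symm
        subst ht
        exact (hc t (by simp)).bump_bump hb

namespace Tableau

/-- Row-insertion of an integer into a tableau. -/
def insert (T : Tableau) (x : ℤ) : Tableau := ⟨insertRows T.rows x, T.isTableau.insertRows x⟩

/-- The product `P · Q` of tableaux: the entries of `Q` are row-inserted into `P`, from the bottom
row of `Q` to its top row and from left to right in each row. -/
instance : Mul Tableau := ⟨fun P Q => Q.word.foldl insert P⟩

/-- The shape of `W` contains the rectangle with `a` rows and `b` columns. -/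
def ContainsRect (a b : ℕ) (W : Tableau) : Prop := ∀ i < a, b ≤ W.rowLen i

/-- The shape of `T` is the rectangle with `a` rows and `b` columns. -/
def IsRect (a b : ℕ) (T : Tableau) : Prop := ∀ i, T.rowLen i = if i < a then b else 0

/-- `W` contains the tableau `T`, whose shape is the rectangle with `a` rows and `b` columns, in
its upper-left corner. -/
def HasCorner (a b : ℕ) (W T : Tableau) : Prop := W.ContainsRect a b ∧ T = (W.top a).left b

end Tableau

/-- `W = Q · T · P` is a simple factorization of `W` with respect to the rectangle with `a` rows
and `b` columns: `T` is the part of `W` in this rectangle, and `Q = Q₀ · Q'`, `P = P' · P₀` for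
some factorization `Z = Q' · P'`, where `Q₀` is the part of `W` below `T`, `P₀` the part to the
right of `T`, and `Z` the remaining part of `W`. -/
structure IsSimpleFactorization (a b : ℕ) (W Q T P : Tableau) : Prop where
  corner : W.HasCorner a b T
  eq_mul : W = Q * T * P
  exists_factor : ∃ Q' P' : Tableau, (W.below a).right b = Q' * P' ∧
    Q = (W.below a).left b * Q' ∧ P = P' * (W.top a).right b

/-- The relation `(X, Y) ⊨ (X', Y')` with respect to a tableau `T` of rectangular shape with `a`
rows and `b` columns. -/
def Models (a b : ℕ) (T : Tableau) (p p' : Tableau × Tableau) : Prop :=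
  (∀ t, T.HasEntry t → (∀ x, p.1.HasEntry x → t < x) ∧ (∀ y, p.2.HasEntry y → t < y)) ∧
  ((∃ M N : Tableau, p.1.right b = M * N ∧ p'.1 = p.1.left b * M ∧ p'.2 = N * p.2) ∨
   (∃ M N : Tableau, p.2.below a = M * N ∧ p'.1 = p.1 * M ∧ p'.2 = N * p.2.top a))

/-- The relation `(X, Y) → (X', Y')`: the transitive closure of `⊨`. -/
def Leads (a b : ℕ) (T : Tableau) : Tableau × Tableau → Tableau × Tableau → Prop :=
  Relation.TransGen (Models a b T)

/-! ### Rectangle diagrams and tableau diagrams -/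

/-- A rectangle diagram: rectangles `R i j` for `0 ≤ i < j ≤ n`, arranged in a triangle with the
`R i (i+1)` in its top row and `R 0 n` at the bottom. The rectangles get shorter when one moves
south-east (from `R i j` to `R i (j+1)`) and narrower when one moves south-west (from `R (i+1) j`
to `R i j`). Values outside `i < j ≤ n` are irrelevant. -/
structure RectDiagram (n : ℕ) where
  numRows : ℕ → ℕ → ℕ
  numCols : ℕ → ℕ → ℕ
  numRows_le : ∀ i j, i < j → j + 1 ≤ n → numRows i (j + 1) ≤ numRows i j
  numCols_le : ∀ i j, i + 1 < j → j ≤ n → numCols i j ≤ numCols (i + 1) j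

/-- The rectangle diagram of rank conditions `r i j`, `0 ≤ i ≤ j ≤ n`, that can occur. -/
def RectDiagram.ofRank (n : ℕ) (r : ℕ → ℕ → ℕ)
    (h₁ : ∀ i j, i < j → j ≤ n → r i j ≤ r i (j - 1) ∧ r i j ≤ r (i + 1) j)
    (h₂ : ∀ i j, i + 2 ≤ j → j ≤ n → r i (j - 1) + r (i + 1) j ≤ r i j + r (i + 1) (j - 1)) :
    RectDiagram n where
  numRows i j := r (i + 1) j - r i j
  numCols i j := r i (j - 1) - r i j
  numRows_le i j hij hj := by
    have a := h₁ i (j + 1) (by omega) hj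
    have b := h₁ i j hij (by omega)
    have c := h₂ i (j + 1) (by omega) hj
    simp only [Nat.add_sub_cancel] at a c
    omega
  numCols_le i j hij hj := by
    have a := h₁ i j (by omega) hj
    have b := h₁ (i + 1) j hij hj
    have c := h₂ i j (by omega) hj
    omega

/-- A tableau diagram: a filling of the boxes of a rectangle diagram with integers, such that each
rectangle becomes a tableau `T i j`, the entries of which are strictly larger than the entries of
all `T k l` with `i ≤ k < l ≤ j` and `(k, l) ≠ (i, j)`. -/
structure TableauDiagram {n : ℕ} (R : RectDiagram n) where
  T : ℕ → ℕ → Tableau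
  isRect : ∀ i j, i < j → j ≤ n → (T i j).IsRect (R.numRows i j) (R.numCols i j)
  entry_lt : ∀ i j k l, i ≤ k → k < l → l ≤ j → j ≤ n → (k, l) ≠ (i, j) →
    ∀ x y, (T k l).HasEntry x → (T i j).HasEntry y → x < y

/-! ### Paths through the rank diagram

The rank diagram is the triangle of points `(i, j)`, `0 ≤ i ≤ j ≤ n`; the point `(i, j)` is in
row `j - i` (counted downwards) and has horizontal coordinate `i + j`. -/

/-- The line segments between neighboring points, travelled from left to right:
`down` goes from `(i, j)` to `(i, j + 1)`, `up` from `(i, j)` to `(i + 1, j)`, and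
`horiz` from `(i, j)` to `(i + 1, j + 1)`. -/
inductive Step
  | down
  | up
  | horiz
  deriving DecidableEq

open Step

/-- The point reached from `(0, 0)` after a sequence of steps. -/
def endpoint (γ : List Step) : ℕ × ℕ :=
  (γ.count up + γ.count horiz, γ.count down + γ.count horiz)

/-- A path through the rank diagram: it goes from `(0, 0)` to `(n, n)` inside the triangle. -/
def IsPath (n : ℕ) (γ : List Step) : Prop :=
  endpoint γ = (n, n) ∧ ∀ δ, δ <+: γ → (endpoint δ).1 ≤ (endpoint δ).2

/-- The path `γ` is obtained from the lower path `γ'` by replacing a horizontal segment, preceded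
by the steps `α`, by an up-going and a down-going segment. -/
structure IsCase1 (n : ℕ) (α : List Step) (γ γ' : List Step) : Prop where
  isPath : IsPath n γ
  isPath' : IsPath n γ'
  exists_rest : ∃ β, γ = α ++ [up, down] ++ β ∧ γ' = α ++ [horiz] ++ β

/-- The path `γ` is obtained from the lower path `γ'` by replacing a down-going and an up-going
segment, preceded by the steps `α`, by a horizontal segment. The triangle between the two paths
has the vertices `(i, j - 1)`, `(i, j)`, `(i + 1, j)`, where `(i, j - 1)` is the endpoint
of `α`. -/
structure IsCase2 (n : ℕ) (α : List Step) (i j : ℕ) (γ γ' : List Step) : Prop where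
  isPath : IsPath n γ
  isPath' : IsPath n γ'
  exists_rest : ∃ β, γ = α ++ [horiz] ++ β ∧ γ' = α ++ [down, up] ++ β
  start : endpoint α = (i, j - 1)
  pos : 0 < j

/-- `IsFactorSeq 𝒯 γ L`: the sequence of tableaux `L`, regarded as a labeling of the segments of
the path `γ` from left to right, is a factor sequence for `γ`. -/
inductive IsFactorSeq {n : ℕ} {R : RectDiagram n} (𝒯 : TableauDiagram R) :
    List Step → List Tableau → Prop
  | lowest : IsFactorSeq 𝒯 (List.replicate n down ++ List.replicate n up)
      (List.replicate (2 * n) ∅)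
  | case1 {α γ γ' : List Step} {A B : List Tableau} (P Q : Tableau)
      (hγ : IsCase1 n α γ γ') (hA : A.length = α.length)
      (h : IsFactorSeq 𝒯 γ' (A ++ [P * Q] ++ B)) :
      IsFactorSeq 𝒯 γ (A ++ [P, Q] ++ B)
  | case2 {α γ γ' : List Step} {i j : ℕ} {A B : List Tableau} (Q P : Tableau)
      (hγ : IsCase2 n α i j γ γ') (hA : A.length = α.length)
      (h : IsFactorSeq 𝒯 γ' (A ++ [Q, P] ++ B)) :
      IsFactorSeq 𝒯 γ (A ++ [Q * 𝒯.T i j * P] ++ B)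

end FactorSeq

namespace FactorSeq

/-! Product of tableaux is associative because row insertion is invariant under Knuth equivalence.
This makes all regrouping of factors below legitimate.

Consider the vertex `(i, j)` under a horizontal step with label W. The rules that build factor
sequences at different places commute, so a derivation can be reordered: an up-down pair always
comes from the product of its labels (`IsLabeled.up_down_inv`), and a horizontal label always has at
least one factorization W = X·T·Y with (X, Y) admissible on the lower path (`IsLabeled.horiz_inv`).
The theorem follows from two facts about admissible pairs.

Closure: ⊨ preserves admissibility (`IsLabeled.models`). Say X = X₀·M·N and N is to be moved to Y.
Lowering the path further to the left puts an up step with some label Z before the down step, so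
Z·X₀·M·N labels a horizontal step over the triangle `(i - 1, j)`, for which the theorem is known by
induction. Here N leaves the first b columns of X₀·M alone (`fixesCols_of_right_eq`). It still does
so after multiplication by Z from the left (`FixesCols.mul_left`), because left multiplication is
column insertion and works from left to right. The rectangle at `(i - 1, j)` has at most b columns,
so N is a right factor of the up-going label in a suitable simple factorization. A right factor of
an up-going label can always pass to the next step (`IsLabeled.move_right_of_up`), because an
up-down pair is an arbitrary splitting of a product. Reassembling finishes the move. The other kind
of ⊨ is dual, with rows, `FixesRows` and the triangle `(i, j + 1)`.

Reaching (`IsRect.reaches`): all entries of X and Y exceed those of T (`IsLabeled.smaller`). Hence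
X·T·Y is unchanged when everything right of column b moves from X to Y, and then everything below
row a moves from Y to X. If the moved part fits beside X₀, the pieces form a tableau with T in its
corner; otherwise the first b columns of X have grown (`fixesCols_or_lt`), so the process stops. It
stops at the pair with all of Z in the first factor, and any simple factorization is one more ⊨ step
away. This gives part 1; part 2 is closure, iterated. -/

/-! ### Knuth equivalence and associativity of the product -/

/-- Knuth (plactic) equivalence of words. -/
inductive KnuthEq : List ℤ → List ℤ → Prop
  | refl (w) : KnuthEq w w
  | symm {v w} : KnuthEq v w → KnuthEq w v
  | trans {u v w} : KnuthEq u v → KnuthEq v w → KnuthEq u w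
  | append {v w} (p s : List ℤ) : KnuthEq v w → KnuthEq (p ++ v ++ s) (p ++ w ++ s)
  | yzx {x y z : ℤ} : x < y → y ≤ z → KnuthEq [y, z, x] [y, x, z]
  | xzy {x y z : ℤ} : x ≤ y → y < z → KnuthEq [x, z, y] [z, x, y]

theorem KnuthEq.append_left {v w : List ℤ} (p : List ℤ) (h : KnuthEq v w) :
    KnuthEq (p ++ v) (p ++ w) := by
  simpa using h.append p []

theorem KnuthEq.append_right {v w : List ℤ} (s : List ℤ) (h : KnuthEq v w) :
    KnuthEq (v ++ s) (w ++ s) := by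
  simpa using h.append [] s

theorem KnuthEq.cons {v w : List ℤ} (a : ℤ) (h : KnuthEq v w) : KnuthEq (a :: v) (a :: w) :=
  h.append_left [a]

theorem KnuthEq.perm {v w : List ℤ} (h : KnuthEq v w) : v.Perm w := by
  induction h with
  | refl w => exact .refl w
  | symm _ ih => exact ih.symm
  | trans _ _ ih₁ ih₂ => exact ih₁.trans ih₂
  | append p s _ ih => exact (ih.append_left p).append_right s
  | yzx _ _ => exact (List.Perm.swap _ _ _).cons _
  | xzy _ _ => exact List.Perm.swap _ _ _

/-- Row-insert the letters of a word into a list of rows. -/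
def insertWord (rs : List (List ℤ)) (w : List ℤ) : List (List ℤ) := w.foldl insertRows rs

/-- Row-insert the letters of a word into a single row, collecting the bumped letters. -/
def bumpWord : List ℤ → List ℤ → List ℤ × List ℤ
  | r, [] => ([], r)
  | r, x :: w => ((bump x r).1.toList ++ (bumpWord (bump x r).2 w).1, (bumpWord (bump x r).2 w).2)

@[simp] theorem insertWord_nil_right (rs : List (List ℤ)) : insertWord rs [] = rs := rfl

theorem insertWord_append (rs : List (List ℤ)) (v w : List ℤ) :
    insertWord rs (v ++ w) = insertWord (insertWord rs v) w := List.foldl_append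

theorem insertWord_cons (r : List ℤ) (rs : List (List ℤ)) (w : List ℤ) :
    insertWord (r :: rs) w = (bumpWord r w).2 :: insertWord rs (bumpWord r w).1 := by
  induction w generalizing r rs with
  | nil => rfl
  | cons x w ih =>
    cases h : (bump x r).1 <;>
      simp only [insertWord, List.foldl_cons, insertRows, bumpWord, h, Option.toList] <;>
      exact ih _ _

theorem insertWord_nil {w : List ℤ} (hw : w ≠ []) :
    insertWord [] w = (bumpWord [] w).2 :: insertWord [] (bumpWord [] w).1 := by
  cases w with
  | nil => exact absurd rfl hw
  | cons x w =>
    simpa [bumpWord, bump, insertWord, insertRows] using insertWord_cons [x] [] w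

theorem IsTableau.insertWord {rs : List (List ℤ)} (h : IsTableau rs) (w : List ℤ) :
    IsTableau (insertWord rs w) := by
  induction w generalizing rs with
  | nil => exact h
  | cons x w ih => exact ih (h.insertRows x)

theorem bump_fst_mem {x y : ℤ} : ∀ {r : List ℤ}, (bump x r).1 = some y → y ∈ r
  | [], h => by simp [bump] at h
  | z :: r, h => by
    by_cases hxz : x < z
    · simp_all [bump]
    · simp only [bump, hxz, if_false] at h
      exact List.mem_cons_of_mem _ (bump_fst_mem h)

theorem bump_eq_none {x : ℤ} : ∀ {r : List ℤ}, (bump x r).1 = none →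
    (bump x r).2 = r ++ [x] ∧ ∀ y ∈ r, y ≤ x
  | [], _ => by simp [bump]
  | z :: r, h => by
    by_cases hxz : x < z
    · simp [bump, hxz] at h
    · simp only [bump, hxz, if_false] at h ⊢
      have := bump_eq_none h
      refine ⟨by simp [this.1], ?_⟩
      intro y hy
      rcases List.mem_cons.1 hy with rfl | hy
      · exact not_lt.1 hxz
      · exact this.2 y hy

/-- After y has been inserted, a letter z ≥ y acts strictly to the right of y's position, so the
letters bumped out come in weakly increasing order. -/
theorem bump_bump_of_le {y z u : ℤ} (hyz : y ≤ z) : ∀ {r : List ℤ}, r.Pairwise (· ≤ ·) →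
    (bump z (bump y r).2).1 = some u → ∃ v, (bump y r).1 = some v ∧ v ≤ u
  | [], _, h => by simp [bump, not_lt.2 hyz] at h
  | a :: r, hr, h => by
    rw [List.pairwise_cons] at hr
    by_cases hya : y < a
    · simp only [bump, hya, if_true, not_lt.2 hyz, if_false] at h ⊢
      exact ⟨a, rfl, hr.1 _ (bump_fst_mem h)⟩
    · have hza : ¬ z < a := by omega
      simp only [bump, hya, if_false, hza] at h ⊢
      exact bump_bump_of_le hyz hr.2 h

theorem bump_bump_of_lt {y z : ℤ} (hyz : y < z) : ∀ {r : List ℤ}, r.Pairwise (· ≤ ·) →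
    ∃ v, (bump y (bump z r).2).1 = some v ∧ v ≤ z
  | [], _ => by simp [bump, hyz]
  | a :: r, hr => by
    rw [List.pairwise_cons] at hr
    by_cases hza : z < a
    · simp [bump, hza, hyz]
    · by_cases hya : y < a
      · simp [bump, hza, hya, not_lt.1 hza]
      · simp only [bump, hya, if_false, hza]
        exact bump_bump_of_lt hyz hr.2

/-- An elementary Knuth relation, in one of the two directions. -/
inductive KnuthStep : List ℤ → List ℤ → Prop
  | yzx {x y z : ℤ} : x < y → y ≤ z → KnuthStep [y, z, x] [y, x, z]
  | xzy {x y z : ℤ} : x ≤ y → y < z → KnuthStep [x, z, y] [z, x, y]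

theorem bumpWord_cons_cons {a : ℤ} {r w : List ℤ} (h : ∀ x ∈ w, a ≤ x) :
    bumpWord (a :: r) w = ((bumpWord r w).1, a :: (bumpWord r w).2) := by
  induction w generalizing r with
  | nil => rfl
  | cons x w ih =>
    have hx : ¬ x < a := not_lt.2 (h x (by simp))
    simp only [bumpWord, bump, hx, if_false]
    rw [ih fun y hy => h y (by simp [hy])]

/-- This drives the induction over rows: one row cannot tell the two words apart, and it hands to
the next row words that are equal or again related by one Knuth relation. Leading entries that no
letter of the word bumps are stripped off; then only the first entry `a` with `x < a` matters. -/
theorem KnuthStep.bumpWord {v w : List ℤ} (h : KnuthStep v w) : ∀ {r : List ℤ},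
    r.Pairwise (· ≤ ·) → (bumpWord r v).2 = (bumpWord r w).2 ∧
      ((bumpWord r v).1 = (bumpWord r w).1 ∨ KnuthStep (bumpWord r v).1 (bumpWord r w).1)
  | [], _ => by
    cases h with
    | @yzx x y z h₁ h₂ =>
      simp [FactorSeq.bumpWord, bump, h₁, not_lt.2 h₂, not_lt.2 (h₁.le.trans h₂)]
    | @xzy x y z h₁ h₂ =>
      simp [FactorSeq.bumpWord, bump, h₂, not_lt.2 h₁, h₁.trans_lt h₂, not_lt.2 (h₁.trans h₂.le)]
  | a :: r, hr => by
    have hr' := List.pairwise_cons.1 hr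
    by_cases hall : ∀ x ∈ v, a ≤ x
    · have hall' : ∀ x ∈ w, a ≤ x := by
        cases h <;> simp at hall ⊢ <;> tauto
      rw [bumpWord_cons_cons hall, bumpWord_cons_cons hall']
      have := h.bumpWord hr'.2
      simpa using this
    · cases h with
      | @yzx x y z h₁ h₂ =>
        have hxa : x < a := by
          by_contra hxa
          apply hall
          simp
          omega
        by_cases hya : y < a
        · have hzy : ¬ z < y := not_lt.2 h₂
          have hzx : ¬ z < x := by omega
          simp only [FactorSeq.bumpWord, bump, hya, if_true, hzy, if_false, h₁, hzx,
            true_and, Option.toList, List.append_nil]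
          cases hz : (bump z r).1 with
          | none => simp
          | some u =>
            right
            exact .yzx hya (hr'.1 u (bump_fst_mem hz))
        · have hza : ¬ z < a := by omega
          have hzx : ¬ z < x := by omega
          simp only [FactorSeq.bumpWord, bump, hya, if_false, hza, hxa, if_true, hzx,
            true_and, Option.toList, List.append_nil]
          cases hz : (bump z (bump y r).2).1 with
          | none => simp
          | some u =>
            obtain ⟨v, hv, hvu⟩ := bump_bump_of_le h₂ hr'.2 hz
            rw [hv]
            right
            exact .yzx ((not_lt.1 hya).trans_lt (lt_of_bump hv)) hvu
      | @xzy x y z h₁ h₂ =>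
        have hxa : x < a := by
          by_contra hxa
          apply hall
          simp
          omega
        have hyx : ¬ y < x := not_lt.2 h₁
        have hzx : ¬ z < x := by omega
        by_cases hza : z < a
        · have hxz : x < z := by omega
          simp only [FactorSeq.bumpWord, bump, hxa, if_true, hzx, hza, if_false, hxz, hyx,
            Option.toList, List.append_nil]
          cases r with
          | nil => simp [bump, h₂]
          | cons c r =>
            have hac := hr'.1 c (by simp)
            have hzc : z < c := by omega
            have hyc : y < c := by omega
            simp only [bump, hzc, if_true, h₂, hyc, true_and]
            right
            -- The relation changes type: the bumped words are a, c, z and a, z, c with z < a ≤ c.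
            exact .yzx hza hac
        · simp only [FactorSeq.bumpWord, bump, hxa, if_true, hzx, if_false, hza, hyx,
            true_and, Option.toList, List.append_nil]
          cases hz : (bump z r).1 with
          | none => simp
          | some u =>
            obtain ⟨v, hv, hvz⟩ := bump_bump_of_lt h₂ hr'.2
            rw [hv]
            right
            refine .xzy ?_ (hvz.trans_lt (lt_of_bump hz))
            rcases mem_bump (bump_fst_mem hv) with rfl | hm
            · exact not_lt.1 hza
            · exact hr'.1 v hm

theorem KnuthStep.insertWord_eq : ∀ {rs : List (List ℤ)} {v w : List ℤ}, KnuthStep v w →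
    (∀ r ∈ rs, r.Pairwise (· ≤ ·)) → insertWord rs v = insertWord rs w
  | [], _, _, h, _ => by
    cases h with
    | @yzx x y z h₁ h₂ =>
      simp [insertWord, insertRows, bump, h₁, not_lt.2 h₂, not_lt.2 (h₁.le.trans h₂)]
    | @xzy x y z h₁ h₂ =>
      simp [insertWord, insertRows, bump, h₂, not_lt.2 h₁, h₁.trans_lt h₂,
        not_lt.2 (h₁.trans h₂.le)]
  | r :: rs, v, w, h, hr => by
    rw [insertWord_cons, insertWord_cons]
    obtain ⟨h₁, h₂⟩ := h.bumpWord (hr r (by simp))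
    rw [h₁]
    rcases h₂ with h₂ | h₂
    · rw [h₂]
    · rw [h₂.insertWord_eq fun s hs => hr s (by simp [hs])]

theorem KnuthEq.insertWord_eq {v w : List ℤ} (h : KnuthEq v w) {rs : List (List ℤ)}
    (hr : IsTableau rs) : insertWord rs v = insertWord rs w := by
  induction h generalizing rs with
  | refl w => rfl
  | symm _ ih => exact (ih hr).symm
  | trans _ _ ih₁ ih₂ => exact (ih₁ hr).trans (ih₂ hr)
  | append p s _ ih => simp only [insertWord_append, ih (hr.insertWord p)]
  | yzx h₁ h₂ => exact (KnuthStep.yzx h₁ h₂).insertWord_eq hr.row_weak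
  | xzy h₁ h₂ => exact (KnuthStep.xzy h₁ h₂).insertWord_eq hr.row_weak

theorem knuthEq_move_left {x : ℤ} : ∀ {a : ℤ} {r : List ℤ}, (a :: r).Pairwise (· ≤ ·) → x < a →
    KnuthEq (a :: r ++ [x]) (a :: x :: r)
  | _, [], _, _ => .refl _
  | a, c :: r, hr, hx => by
    have hr' := List.pairwise_cons.1 hr
    have hac := hr'.1 c (by simp)
    exact ((knuthEq_move_left hr'.2 (hx.trans_le hac)).cons a).trans
      ((KnuthEq.yzx hx hac).append_right r)

/-- Bumping is a chain of Knuth relations: x travels left to its place, then the letter it displaces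
travels left to the front. -/
theorem knuthEq_bump {x : ℤ} : ∀ {r : List ℤ}, r.Pairwise (· ≤ ·) →
    KnuthEq (r ++ [x]) ((bump x r).1.toList ++ (bump x r).2)
  | [], _ => .refl _
  | a :: r, hr => by
    have hr' := List.pairwise_cons.1 hr
    by_cases hxa : x < a
    · simp only [bump, hxa, if_true]
      exact knuthEq_move_left hr hxa
    · have ih := (knuthEq_bump (x := x) hr'.2).cons a
      simp only [bump, hxa, if_false]
      cases hb : (bump x r).1 with
      | none => simpa [hb] using ih
      | some y =>
        rw [hb] at ih
        refine ih.trans ?_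
        have hxy := lt_of_bump hb
        cases r with
        | nil => simp [bump] at hb
        | cons c r =>
          by_cases hxc : x < c
          · simp only [bump, hxc, if_true, Option.toList]
            exact (KnuthEq.xzy (not_lt.1 hxa) hxy).append_right r
          · simp only [bump, hxc, if_false, Option.toList]
            exact (KnuthEq.xzy (hr'.1 c (by simp)) (by omega)).append_right _

theorem knuthEq_insertRows : ∀ {rs : List (List ℤ)} {x : ℤ}, (∀ r ∈ rs, r.Pairwise (· ≤ ·)) →
    KnuthEq (rs.reverse.flatten ++ [x]) (insertRows rs x).reverse.flatten
  | [], _, _ => by simpa [insertRows] using .refl _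
  | r :: rs, x, hr => by
    have h := (knuthEq_bump (x := x) (hr r (by simp))).append_left rs.reverse.flatten
    cases hb : (bump x r).1 with
    | none => simpa [insertRows, hb] using h
    | some y =>
      have ih := (knuthEq_insertRows (x := y) fun s hs => hr s (List.mem_cons_of_mem _ hs))
      simp only [insertRows, hb, List.reverse_cons, List.flatten_append, List.flatten_singleton,
        List.append_assoc]
      rw [hb] at h
      exact h.trans (by simpa using ih.append_right (bump x r).2)

theorem knuthEq_insertWord {rs : List (List ℤ)} (hr : IsTableau rs) (w : List ℤ) :
    KnuthEq (rs.reverse.flatten ++ w) (insertWord rs w).reverse.flatten := by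
  induction w generalizing rs with
  | nil => simpa using .refl _
  | cons x w ih =>
    have h := (knuthEq_insertRows (x := x) hr.row_weak).append_right w
    exact (by simpa using h : KnuthEq _ _).trans (ih (hr.insertRows x))

namespace Tableau

theorem rows_mul (P Q : Tableau) : (P * Q).rows = insertWord P.rows Q.word := by
  change (Q.word.foldl insert P).rows = _
  induction Q.word generalizing P with
  | nil => rfl
  | cons x w ih => exact ih _

theorem knuthEq_word_mul (P Q : Tableau) : KnuthEq (P.word ++ Q.word) (P * Q).word := by
  unfold word
  rw [rows_mul]
  exact knuthEq_insertWord P.isTableau _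

/-- P·(Q·R) inserts the word of Q·R into P, and (P·Q)·R inserts the concatenated words of Q and R;
these words are Knuth equivalent. -/
instance : Semigroup Tableau where
  mul_assoc P Q R := by
    ext1
    rw [rows_mul, rows_mul, rows_mul, ← insertWord_append]
    exact (Q.knuthEq_word_mul R).insertWord_eq P.isTableau

end Tableau
end FactorSeq

namespace FactorSeq

/-! ### Rows of tableaux, padded by empty rows -/

theorem above_nil (r : List ℤ) : Above r [] := by
  cases r <;> simp [Above]

theorem Above.length_le : ∀ {r s : List ℤ}, Above r s → s.length ≤ r.length
  | _, [], _ => by simp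
  | [], _ :: _, h => by simp [Above] at h
  | _ :: _, _ :: _, h => by simpa using h.2.length_le

theorem Above.exists_lt : ∀ {r s : List ℤ}, Above r s → ∀ y ∈ s, ∃ x ∈ r, x < y
  | _, [], _ => by simp
  | [], _ :: _, h => by simp [Above] at h
  | a :: r, b :: s, h => by
    intro y hy
    rcases List.mem_cons.1 hy with rfl | hy
    · exact ⟨a, by simp, h.1⟩
    · obtain ⟨x, hx, hxy⟩ := h.2.exists_lt y hy
      exact ⟨x, by simp [hx], hxy⟩

theorem Above.append : ∀ {r s r' s' : List ℤ}, Above r s → Above r' s' →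
    (r.length = s.length ∨ s' = []) → Above (r ++ r') (s ++ s')
  | [], [], _, _, _, h', _ => by simpa using h'
  | _ :: _, [], _, _, _, _, hl => by
    rcases hl with hl | rfl
    · simp at hl
    · simp [Above]
  | [], _ :: _, _, _, h, _, _ => by simp [Above] at h
  | _ :: _, _ :: _, _, _, h, h', hl => ⟨h.1, h.2.append h' (by simpa using hl)⟩

theorem above_of_forall_lt : ∀ {r s : List ℤ}, s.length ≤ r.length →
    (∀ x ∈ r, ∀ y ∈ s, x < y) → Above r s
  | _, [], _, _ => above_nil _
  | [], _ :: _, h, _ => by simp at h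
  | a :: r, b :: s, h, hlt => ⟨hlt a (by simp) b (by simp),
      above_of_forall_lt (by simpa using h) fun x hx y hy => hlt x (by simp [hx]) y (by simp [hy])⟩

/-- Only empty rows can follow an empty row, so discarding them shifts no index. This lets tableaux
be handled through rows indexed by all natural numbers. -/
theorem getD_filter_of_pairwise_above : ∀ {l : List (List ℤ)}, l.Pairwise Above → ∀ i,
    (l.filter (fun r => !r.isEmpty)).getD i [] = l.getD i []
  | [], _, _ => by simp
  | r :: l, h, i => by
    rw [List.pairwise_cons] at h
    cases r with
    | nil =>
      have hnil : ∀ s ∈ l, s = [] := fun s hs => by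
        have := (h.1 s hs).length_le
        simpa using this
      have h₁ : l.filter (fun r => !r.isEmpty) = [] := by
        rw [List.filter_eq_nil_iff]
        intro s hs
        simp [hnil s hs]
      have h₂ : ∀ k, l.getD k [] = [] := fun k => by
        rw [List.getD_eq_getElem?_getD]
        cases hk : l[k]? with
        | none => rfl
        | some s => exact hnil s (List.mem_of_getElem? hk)
      rw [List.filter_cons_of_neg (by simp), h₁]
      cases i with
      | zero => simp
      | succ i => simpa using (h₂ i).symm
    | cons x r =>
      cases i with
      | zero => simp
      | succ i => simpa using getD_filter_of_pairwise_above h.2 i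

theorem isChain_above_iff {l : List (List ℤ)} :
    l.IsChain Above ↔ ∀ i, Above (l.getD i []) (l.getD (i + 1) []) := by
  induction l with
  | nil => simp [above_nil]
  | cons r l ih =>
    rw [List.isChain_cons, ih]
    constructor
    · rintro ⟨h₁, h₂⟩ i
      cases i with
      | succ i => simpa using h₂ i
      | zero =>
        cases l with
        | nil => simp [above_nil]
        | cons s l => simpa using h₁
    · intro h
      refine ⟨?_, fun i => by simpa using h (i + 1)⟩
      cases l with
      | nil => simp
      | cons s l => simpa using h 0

theorem getD_mem_or_eq_nil (l : List (List ℤ)) (i : ℕ) : l.getD i [] ∈ l ∨ l.getD i [] = [] := by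
  rw [List.getD_eq_getElem?_getD]
  cases hk : l[i]? with
  | none => exact .inr rfl
  | some s => exact .inl (List.mem_of_getElem? hk)

namespace Tableau

/-- The `i`-th row (numbered from `0`), which is empty if there is no such row. -/
def row (T : Tableau) (i : ℕ) : List ℤ := T.rows.getD i []

theorem row_sorted (T : Tableau) (i : ℕ) : (T.row i).Pairwise (· ≤ ·) := by
  rcases getD_mem_or_eq_nil T.rows i with h | h
  · exact T.isTableau.row_weak _ h
  · rw [row, h]
    exact .nil

theorem row_above (T : Tableau) (i : ℕ) : Above (T.row i) (T.row (i + 1)) :=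
  isChain_above_iff.1 T.isTableau.col_strict i

theorem row_eq_nil {T : Tableau} {i : ℕ} (h : T.rows.length ≤ i) : T.row i = [] :=
  List.getD_eq_default _ _ h

theorem row_ne_nil {T : Tableau} {i : ℕ} (h : i < T.rows.length) : T.row i ≠ [] := by
  rw [row, List.getD_eq_getElem _ _ h]
  exact T.isTableau.ne_nil _ (List.getElem_mem h)

theorem row_ext {A B : Tableau} (h : ∀ i, A.row i = B.row i) : A = B := by
  have hl : A.rows.length = B.rows.length := by
    rcases lt_trichotomy A.rows.length B.rows.length with hl | hl | hl
    · exact absurd ((h _).symm.trans (row_eq_nil le_rfl)) (row_ne_nil hl)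
    · exact hl
    · exact absurd ((h _).trans (row_eq_nil le_rfl)) (row_ne_nil hl)
  ext1
  refine List.ext_getElem hl fun i h₁ h₂ => ?_
  have := h i
  rwa [row, row, List.getD_eq_getElem _ _ h₁, List.getD_eq_getElem _ _ h₂] at this

theorem hasEntry_iff_row {T : Tableau} {x : ℤ} : T.HasEntry x ↔ ∃ i, x ∈ T.row i := by
  constructor
  · rintro ⟨r, hr, hx⟩
    obtain ⟨i, hi, rfl⟩ := List.getElem_of_mem hr
    exact ⟨i, by rwa [row, List.getD_eq_getElem _ _ hi]⟩
  · rintro ⟨i, hx⟩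
    rcases getD_mem_or_eq_nil T.rows i with h | h
    · exact ⟨_, h, hx⟩
    · rw [row, h] at hx
      simp at hx

@[simp] theorem row_empty (i : ℕ) : (∅ : Tableau).row i = [] := row_eq_nil (Nat.zero_le _)

theorem row_left (b : ℕ) (T : Tableau) (i : ℕ) : (T.left b).row i = (T.row i).take b := by
  unfold row left
  rw [getD_filter_of_pairwise_above
    (List.pairwise_map.2 (T.isTableau.pairwise.imp fun h => h.take b))]
  simp only [List.getD_eq_getElem?_getD, List.getElem?_map]
  cases T.rows[i]? <;> simp

theorem row_right (b : ℕ) (T : Tableau) (i : ℕ) : (T.right b).row i = (T.row i).drop b := by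
  unfold row right
  rw [getD_filter_of_pairwise_above
    (List.pairwise_map.2 (T.isTableau.pairwise.imp fun h => h.drop b))]
  simp only [List.getD_eq_getElem?_getD, List.getElem?_map]
  cases T.rows[i]? <;> simp

theorem row_top (a : ℕ) (T : Tableau) (i : ℕ) :
    (T.top a).row i = if i < a then T.row i else [] := by
  simp only [row, top, List.getD_eq_getElem?_getD, List.getElem?_take]
  split_ifs <;> simp

theorem row_below (a : ℕ) (T : Tableau) (i : ℕ) : (T.below a).row i = T.row (a + i) := by
  simp [row, below, List.getD_eq_getElem?_getD, List.getElem?_drop]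

/-- The tableau with given (padded) rows. -/
def ofRows (f : ℕ → List ℤ) (m : ℕ) (hs : ∀ i, (f i).Pairwise (· ≤ ·))
    (ha : ∀ i, Above (f i) (f (i + 1))) : Tableau where
  rows := ((List.range m).map f).filter (fun r => !r.isEmpty)
  isTableau := by
    have hc : ((List.range m).map f).Pairwise Above := by
      have ht : ∀ i j, i < j → Above (f i) (f j) := fun i j hij => by
        induction j, hij using Nat.le_induction with
        | base => exact ha i
        | succ j _ ih => exact ih.trans (ha j)
      exact List.pairwise_map.2 (List.pairwise_lt_range.imp (ht _ _))
    refine ⟨fun r hr => ?_, fun r hr => ?_, (hc.filter _).isChain⟩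
    · simpa using (List.mem_filter.1 hr).2
    · obtain ⟨i, -, rfl⟩ := List.mem_map.1 (List.mem_filter.1 hr).1
      exact hs i

theorem row_ofRows {f : ℕ → List ℤ} {m : ℕ} (hs : ∀ i, (f i).Pairwise (· ≤ ·))
    (ha : ∀ i, Above (f i) (f (i + 1))) (hm : ∀ i, m ≤ i → f i = []) (i : ℕ) :
    (ofRows f m hs ha).row i = f i := by
  unfold row ofRows
  have ht : ∀ i j, i < j → Above (f i) (f j) := fun i j hij => by
    induction j, hij using Nat.le_induction with
    | base => exact ha i
    | succ j _ ih => exact ih.trans (ha j)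
  rw [getD_filter_of_pairwise_above
    (List.pairwise_map.2 (List.pairwise_lt_range.imp (ht _ _)))]
  simp only [List.getD_eq_getElem?_getD, List.getElem?_map]
  by_cases h : i < m
  · simp [h]
  · simp [h, hm i (not_lt.1 h)]

theorem row_length_anti (T : Tableau) {i j : ℕ} (h : i ≤ j) :
    (T.row j).length ≤ (T.row i).length := by
  induction j, h using Nat.le_induction with
  | base => exact le_rfl
  | succ j _ ih => exact (T.row_above j).length_le.trans ih

theorem exists_le_of_mem_row (T : Tableau) {i j : ℕ} (h : i ≤ j) {y : ℤ} (hy : y ∈ T.row j) :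
    ∃ x ∈ T.row i, x ≤ y := by
  induction j, h using Nat.le_induction generalizing y with
  | base => exact ⟨y, hy, le_rfl⟩
  | succ j _ ih =>
    obtain ⟨z, hz, hzy⟩ := (T.row_above j).exists_lt y hy
    obtain ⟨x, hx, hxz⟩ := ih hz
    exact ⟨x, hx, hxz.trans hzy.le⟩

end Tableau

/-! ### Products of tableaux that fit together -/

theorem bump_append {x : ℤ} {u : List ℤ} (h : ∀ z ∈ u, z ≤ x) (r : List ℤ) :
    bump x (u ++ r) = ((bump x r).1, u ++ (bump x r).2) := by
  induction u with
  | nil => rfl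
  | cons a u ih =>
    have ha : ¬ x < a := not_lt.2 (h a (by simp))
    simp [bump, ha, ih fun z hz => h z (by simp [hz])]

/-- The letters of `r` step over `u` and replace those of `s` one after the other. If `r` is longer
than `s`, the surplus would run into `v`, so `v` must then be empty. -/
theorem bumpWord_of_above : ∀ {r u s v : List ℤ}, r.Pairwise (· ≤ ·) →
    (∀ z ∈ u, ∀ x ∈ r, z ≤ x) → Above r s → (r.length = s.length ∨ v = []) →
    bumpWord (u ++ (s ++ v)) r = (s, u ++ (r ++ v))
  | [], u, s, v, _, _, h, _ => by
    have : s = [] := by simpa using h.length_le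
    simp [bumpWord, this]
  | x :: r, u, s, v, hr, hu, h, hl => by
    rw [List.pairwise_cons] at hr
    have hux : ∀ z ∈ u, z ≤ x := fun z hz => hu z hz x (by simp)
    have hu' : ∀ z ∈ u ++ [x], ∀ y ∈ r, z ≤ y := by
      intro z hz y hy
      rcases List.mem_append.1 hz with hz | hz
      · exact hu z hz y (by simp [hy])
      · rw [List.mem_singleton.1 hz]
        exact hr.1 y hy
    cases s with
    | nil =>
      have hv : v = [] := by simpa using hl
      subst hv
      have ih := bumpWord_of_above (s := []) (v := []) hr.2 hu' (above_nil r) (.inr rfl)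
      rw [bumpWord, bump_append hux]
      simpa [bump] using ih
    | cons y s =>
      have ih := bumpWord_of_above (s := s) (v := v) hr.2 hu' h.2 (by simpa using hl)
      simp only [List.append_assoc, List.singleton_append] at ih
      rw [bumpWord, bump_append hux]
      simp [bump, h.1, ih]

/-- Append the rows of `rs` to the rows of `ls`. -/
def zipAppend : List (List ℤ) → List (List ℤ) → List (List ℤ)
  | [], rs => rs
  | l :: ls, [] => l :: ls
  | l :: ls, r :: rs => (l ++ r) :: zipAppend ls rs

@[simp] theorem zipAppend_nil (ls : List (List ℤ)) : zipAppend ls [] = ls := by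
  cases ls <;> rfl

theorem getD_zipAppend : ∀ (ls rs : List (List ℤ)) (i : ℕ),
    (zipAppend ls rs).getD i [] = ls.getD i [] ++ rs.getD i []
  | [], rs, i => by simp [zipAppend]
  | l :: ls, [], i => by simp [zipAppend]
  | l :: ls, r :: rs, 0 => by simp [zipAppend]
  | l :: ls, r :: rs, i + 1 => by simpa [zipAppend] using getD_zipAppend ls rs i

/-- Inserting `r` pushes each row of the right-hand part down by one, while the left-hand part stays
put. Rows of the right part thus pass through all higher rows on the way to their final place, which
is why entries are compared for all i ≤ j. -/
theorem insertWord_zipAppend : ∀ {ls rs : List (List ℤ)} {r : List ℤ}, r ≠ [] →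
    (∀ s ∈ r :: rs, s ≠ []) → (∀ s ∈ r :: rs, s.Pairwise (· ≤ ·)) → (r :: rs).IsChain Above →
    (∀ i j, i ≤ j → ∀ x ∈ ls.getD i [], ∀ y ∈ (r :: rs).getD j [], x ≤ y) →
    insertWord (zipAppend ls rs) r = zipAppend ls (r :: rs)
  | [], [], r, h0, _, hs, _, _ => by
    have := bumpWord_of_above (u := []) (s := []) (v := []) (hs r (by simp)) (by simp)
      (above_nil r) (.inr rfl)
    simp only [List.nil_append, List.append_nil] at this
    simp [zipAppend, insertWord_nil h0, this]
  | [], s :: rs, r, h0, hn, hs, hc, hle => by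
    rw [List.isChain_cons_cons] at hc
    have := bumpWord_of_above (u := []) (s := s) (v := []) (hs r (by simp)) (by simp)
      hc.1 (.inr rfl)
    simp only [List.nil_append, List.append_nil] at this
    have ih := insertWord_zipAppend (ls := []) (rs := rs) (r := s) (hn s (by simp))
      (fun t ht => hn t (List.mem_cons_of_mem _ ht)) (fun t ht => hs t (List.mem_cons_of_mem _ ht))
      hc.2 (by simp)
    simp only [zipAppend] at ih ⊢
    rw [insertWord_cons, this, ih]
  | l :: ls, [], r, h0, hn, hs, hc, hle => by
    have := bumpWord_of_above (u := l) (s := []) (v := []) (hs r (by simp))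
      (by simpa using hle 0 0 le_rfl) (above_nil r) (.inr rfl)
    simp only [List.append_nil] at this
    simp [zipAppend, insertWord_cons, this]
  | l :: ls, s :: rs, r, h0, hn, hs, hc, hle => by
    rw [List.isChain_cons_cons] at hc
    have := bumpWord_of_above (u := l) (s := s) (v := []) (hs r (by simp))
      (by simpa using hle 0 0 le_rfl) hc.1 (.inr rfl)
    simp only [List.append_nil] at this
    have ih := insertWord_zipAppend (ls := ls) (rs := rs) (r := s) (hn s (by simp))
      (fun t ht => hn t (List.mem_cons_of_mem _ ht)) (fun t ht => hs t (List.mem_cons_of_mem _ ht))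
      hc.2 (fun i j hij => by simpa using hle (i + 1) (j + 1) (by omega))
    simp only [zipAppend] at ih ⊢
    rw [insertWord_cons, this, ih]

theorem insertWord_flatten_reverse : ∀ {ls rs : List (List ℤ)}, IsTableau rs →
    (∀ i j, i ≤ j → ∀ x ∈ ls.getD i [], ∀ y ∈ rs.getD j [], x ≤ y) →
    insertWord ls rs.reverse.flatten = zipAppend ls rs
  | ls, [], _, _ => by simp
  | ls, r :: rs, h, hle => by
    have ih := insertWord_flatten_reverse (ls := ls) h.tail fun i j hij => by
      simpa using hle i (j + 1) (by omega)
    rw [List.reverse_cons, List.flatten_append, insertWord_append, ih, List.flatten_singleton]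
    exact insertWord_zipAppend (h.ne_nil r (by simp)) h.ne_nil h.row_weak h.col_strict hle

namespace Tableau

theorem rows_mul_of_le {A B : Tableau} (h : ∀ i, ∀ x ∈ A.row i, ∀ y ∈ B.row i, x ≤ y) :
    (A * B).rows = zipAppend A.rows B.rows := by
  rw [rows_mul]
  refine insertWord_flatten_reverse B.isTableau fun i j hij x hx y hy => ?_
  obtain ⟨z, hz, hzy⟩ := B.exists_le_of_mem_row hij hy
  exact (h i x hx z hz).trans hzy

theorem row_mul_of_le {A B : Tableau} (h : ∀ i, ∀ x ∈ A.row i, ∀ y ∈ B.row i, x ≤ y) (i : ℕ) :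
    (A * B).row i = A.row i ++ B.row i := by
  rw [row, rows_mul_of_le h, getD_zipAppend]
  rfl

@[simp] theorem empty_mul' (T : Tableau) : ∅ * T = T :=
  row_ext fun i => by rw [row_mul_of_le] <;> simp

@[simp] theorem mul_empty' (T : Tableau) : T * ∅ = T := rfl

/-- The rows of `A` placed on top of the rows of `B`. -/
theorem rows_mul_of_isTableau {A B : Tableau} (h : IsTableau (A.rows ++ B.rows)) :
    (B * A).rows = A.rows ++ B.rows := by
  have h₁ : insertWord [] B.word = B.rows := by
    simpa [zipAppend, word] using insertWord_flatten_reverse (ls := []) B.isTableau (by simp)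
  have h₂ : insertWord [] (A.rows ++ B.rows).reverse.flatten = A.rows ++ B.rows := by
    simpa [zipAppend] using insertWord_flatten_reverse (ls := []) h (by simp)
  rw [List.reverse_append, List.flatten_append, insertWord_append] at h₂
  rw [rows_mul, ← h₂]
  exact congrArg (insertWord · A.word) h₁.symm

theorem below_mul_top (a : ℕ) (T : Tableau) : T.below a * T.top a = T := by
  ext1
  have : (T.top a).rows ++ (T.below a).rows = T.rows := List.take_append_drop a T.rows
  rw [rows_mul_of_isTableau (by rw [this]; exact T.isTableau), this]

theorem left_mul_right (b : ℕ) (T : Tableau) : T.left b * T.right b = T := by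
  refine row_ext fun i => ?_
  rw [row_mul_of_le, row_left, row_right, List.take_append_drop]
  intro i x hx y hy
  rw [row_left] at hx
  rw [row_right] at hy
  have h := T.row_sorted i
  rw [← List.take_append_drop b (T.row i), List.pairwise_append] at h
  exact h.2.2 x hx y hy

theorem hasEntry_iff_mem_word {T : Tableau} {x : ℤ} : T.HasEntry x ↔ x ∈ T.word := by
  simp [HasEntry, word, List.mem_flatten]

theorem hasEntry_mul {P Q : Tableau} {x : ℤ} :
    (P * Q).HasEntry x ↔ P.HasEntry x ∨ Q.HasEntry x := by
  simp only [hasEntry_iff_mem_word]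
  rw [← (P.knuthEq_word_mul Q).perm.mem_iff, List.mem_append]

theorem length_word_mul (P Q : Tableau) :
    (P * Q).word.length = P.word.length + Q.word.length := by
  rw [← (P.knuthEq_word_mul Q).perm.length_eq, List.length_append]

theorem eq_empty_of_forall_not_hasEntry {T : Tableau} (h : ∀ x, ¬ T.HasEntry x) : T = ∅ := by
  refine row_ext fun i => ?_
  rw [row_empty, List.eq_nil_iff_forall_not_mem]
  exact fun x hx => h x (hasEntry_iff_row.2 ⟨i, hx⟩)

theorem hasEntry_of_left {b : ℕ} {T : Tableau} {x : ℤ} (h : (T.left b).HasEntry x) :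
    T.HasEntry x := by
  rw [← left_mul_right b T, hasEntry_mul]
  exact .inl h

theorem hasEntry_of_right {b : ℕ} {T : Tableau} {x : ℤ} (h : (T.right b).HasEntry x) :
    T.HasEntry x := by
  rw [← left_mul_right b T, hasEntry_mul]
  exact .inr h

theorem hasEntry_of_top {a : ℕ} {T : Tableau} {x : ℤ} (h : (T.top a).HasEntry x) :
    T.HasEntry x := by
  rw [← below_mul_top a T, hasEntry_mul]
  exact .inr h

theorem hasEntry_of_below {a : ℕ} {T : Tableau} {x : ℤ} (h : (T.below a).HasEntry x) :
    T.HasEntry x := by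
  rw [← below_mul_top a T, hasEntry_mul]
  exact .inl h

theorem below_left (a b : ℕ) (T : Tableau) : (T.below a).left b = (T.left b).below a :=
  row_ext fun i => by simp only [row_left, row_below]

theorem below_right (a b : ℕ) (T : Tableau) : (T.below a).right b = (T.right b).below a :=
  row_ext fun i => by simp only [row_right, row_below]

theorem top_left (a b : ℕ) (T : Tableau) : (T.top a).left b = (T.left b).top a :=
  row_ext fun i => by
    simp only [row_left, row_top]
    split_ifs <;> simp

theorem top_right (a b : ℕ) (T : Tableau) : (T.top a).right b = (T.right b).top a :=
  row_ext fun i => by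
    simp only [row_right, row_top]
    split_ifs <;> simp

/-- Two tableaux that can be placed next to each other, the left one filling `b` columns. -/
theorem glue {b : ℕ} {A B : Tableau} (hA : ∀ i, (A.row i).length ≤ b)
    (hB : ∀ i, B.row i ≠ [] → b ≤ (A.row i).length)
    (hle : ∀ i, ∀ x ∈ A.row i, ∀ y ∈ B.row i, x ≤ y) :
    (A * B).left b = A ∧ (A * B).right b = B := by
  constructor <;> refine row_ext fun i => ?_
  · rw [row_left, row_mul_of_le hle]
    by_cases h : B.row i = []
    · rw [h, List.append_nil, List.take_of_length_le (hA i)]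
    · rw [List.take_append_of_le_length (hB i h), List.take_of_length_le (hA i)]
  · rw [row_right, row_mul_of_le hle]
    by_cases h : B.row i = []
    · rw [h, List.append_nil, List.drop_eq_nil_of_le (hA i)]
    · exact List.drop_left' (le_antisymm (hA i) (hB i h))

end Tableau
end FactorSeq

namespace FactorSeq

/-! ### Entrywise comparison of rows -/

/-- `Dominates r s`: the row `r` is at least as long as `s`, and its entries are at most the
corresponding entries of `s`. -/
def Dominates : List ℤ → List ℤ → Prop
  | _, [] => True
  | [], _ :: _ => False
  | x :: r, y :: s => x ≤ y ∧ Dominates r s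

theorem dominates_nil (r : List ℤ) : Dominates r [] := by
  cases r <;> simp [Dominates]

theorem Dominates.refl : ∀ r : List ℤ, Dominates r r
  | [] => trivial
  | _ :: r => ⟨le_rfl, .refl r⟩

theorem Dominates.trans : ∀ {r s t : List ℤ}, Dominates r s → Dominates s t → Dominates r t
  | _, _, [], _, _ => dominates_nil _
  | _, [], _ :: _, _, h => by simp [Dominates] at h
  | [], _ :: _, _ :: _, h, _ => by simp [Dominates] at h
  | _ :: _, _ :: _, _ :: _, h, h' => ⟨h.1.trans h'.1, h.2.trans h'.2⟩

theorem Above.dominates : ∀ {r s t : List ℤ}, Above r s → Dominates s t → Above r t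
  | _, _, [], _, _ => above_nil _
  | _, [], _ :: _, _, h => by simp [Dominates] at h
  | [], _ :: _, _ :: _, h, _ => by simp [Above] at h
  | _ :: _, _ :: _, _ :: _, h, h' => ⟨h.1.trans_le h'.1, h.2.dominates h'.2⟩

theorem Dominates.exists_le : ∀ {r s : List ℤ}, Dominates r s → ∀ y ∈ s, ∃ x ∈ r, x ≤ y
  | _, [], _ => by simp
  | [], _ :: _, h => by simp [Dominates] at h
  | a :: r, b :: s, h => by
    intro y hy
    rcases List.mem_cons.1 hy with rfl | hy
    · exact ⟨a, by simp, h.1⟩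
    · obtain ⟨x, hx, hxy⟩ := h.2.exists_le y hy
      exact ⟨x, by simp [hx], hxy⟩

theorem dominates_iff_getElem? : ∀ {r s : List ℤ},
    Dominates r s ↔ ∀ (i : ℕ) (y : ℤ), s[i]? = some y → ∃ x, r[i]? = some x ∧ x ≤ y
  | r, [] => by simp [dominates_nil]
  | [], b :: s => by
    simp only [Dominates, false_iff, not_forall]
    exact ⟨0, b, rfl, by simp⟩
  | a :: r, b :: s => by
    rw [Dominates, dominates_iff_getElem?]
    constructor
    · rintro ⟨h, h'⟩ i y hy
      cases i with
      | zero => simp_all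
      | succ i => simpa using h' i y (by simpa using hy)
    · intro h
      exact ⟨by simpa using h 0 b rfl, fun i y hy => by simpa using h (i + 1) y (by simpa using hy)⟩

theorem dominates_bump {x : ℤ} : ∀ r : List ℤ, Dominates (bump x r).2 r
  | [] => dominates_nil _
  | y :: r => by
    by_cases h : x < y
    · simpa [bump, h, Dominates, h.le] using Dominates.refl r
    · simpa [bump, h, Dominates] using dominates_bump r

theorem Dominates.bump {x : ℤ} : ∀ {r s : List ℤ}, Dominates r s →
    Dominates (bump x r).2 (bump x s).2
  | [], [], _ => .refl _
  | [], _ :: _, h => by simp [Dominates] at h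
  | a :: r, [], _ => by
    by_cases h : x < a
    · simp [FactorSeq.bump, h, Dominates, dominates_nil]
    · simp [FactorSeq.bump, h, Dominates, dominates_nil, not_lt.1 h]
  | a :: r, b :: s, h => by
    have h₁ := h.1
    by_cases ha : x < a
    · have hb : x < b := by omega
      simpa [FactorSeq.bump, ha, hb, Dominates] using h.2
    · by_cases hb : x < b
      · simpa [FactorSeq.bump, ha, hb, Dominates, not_lt.1 ha] using (dominates_bump r).trans h.2
      · simpa [FactorSeq.bump, ha, hb, Dominates, h₁] using h.2.bump

theorem Dominates.bumpWord {r s : List ℤ} (h : Dominates r s) (w : List ℤ) :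
    Dominates (bumpWord r w).2 (bumpWord s w).2 := by
  induction w generalizing r s with
  | nil => exact h
  | cons x w ih => exact ih h.bump

theorem dominates_insertRows {x : ℤ} : ∀ (rs : List (List ℤ)) (i : ℕ),
    Dominates ((insertRows rs x).getD i []) (rs.getD i [])
  | [], _ => by simp [dominates_nil]
  | r :: rs, i => by
    cases i with
    | zero => cases h : (bump x r).1 <;> simpa [insertRows, h] using dominates_bump r
    | succ i =>
      cases h : (bump x r).1 with
      | none => simpa [insertRows, h] using Dominates.refl _
      | some y => simpa [insertRows, h] using dominates_insertRows rs i

theorem dominates_insertWord (rs : List (List ℤ)) (w : List ℤ) (i : ℕ) :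
    Dominates ((insertWord rs w).getD i []) (rs.getD i []) := by
  induction w generalizing rs with
  | nil => exact .refl _
  | cons x w ih => exact (ih (insertRows rs x)).trans (dominates_insertRows rs i)

namespace Tableau

theorem dominates_row_mul (M N : Tableau) (i : ℕ) : Dominates ((M * N).row i) (M.row i) := by
  rw [row, rows_mul]
  exact dominates_insertWord _ _ _

/-- Both first rows arise by inserting the word of N, once into the first row of M and once into the
empty row; row insertion is monotone in the starting row. -/
theorem dominates_row_zero_mul (M N : Tableau) : Dominates ((M * N).row 0) (N.row 0) := by
  have hN : N = ∅ * N := (empty_mul' N).symm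
  by_cases hw : N.word = []
  · have : N = ∅ := eq_empty_of_forall_not_hasEntry fun x hx => by
      rw [hasEntry_iff_mem_word, hw] at hx
      simp at hx
    rw [this, row_empty]
    exact dominates_nil _
  · have h₁ : N.row 0 = (bumpWord [] N.word).2 := by
      conv_lhs => rw [hN, row, rows_mul]
      change (insertWord [] N.word).getD 0 [] = _
      rw [insertWord_nil hw]
      rfl
    have h₂ : (M * N).row 0 = (bumpWord (M.row 0) N.word).2 := by
      rw [row, rows_mul, row]
      cases M.rows with
      | nil => rw [insertWord_nil hw]; rfl
      | cons r rs => rw [insertWord_cons]; rfl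
    rw [h₁, h₂]
    exact (dominates_nil _).bumpWord _

/-! ### Right factors that leave the first columns alone -/

/-- Multiplying `X` by `N` from the right does not affect the first `b` columns of `X`. -/
def FixesCols (b : ℕ) (X N : Tableau) : Prop :=
  (X * N).left b = X.left b ∧ (X * N).right b = X.right b * N

/-- Right multiplication only lengthens rows and lowers their entries. So M lies inside the shape of
`X.right b` with entries at least as large, and hence still fits to the right of `X.left b`. -/
theorem glue_left_of_right_eq {b : ℕ} {X M N : Tableau} (h : X.right b = M * N) :
    (X.left b * M).left b = X.left b ∧ (X.left b * M).right b = M := by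
  have hd : ∀ i, Dominates ((X.row i).drop b) (M.row i) := fun i => by
    rw [← row_right, h]
    exact dominates_row_mul M N i
  refine glue (fun i => by rw [row_left]; exact List.length_take_le _ _) (fun i hi => ?_)
    fun i x hx y hy => ?_
  · obtain ⟨y, hy⟩ := List.exists_mem_of_ne_nil _ hi
    obtain ⟨z, hz, -⟩ := (hd i).exists_le y hy
    have := List.length_pos_of_mem hz
    rw [List.length_drop] at this
    rw [row_left, List.length_take]
    omega
  · obtain ⟨z, hz, hzy⟩ := (hd i).exists_le y hy
    rw [row_left] at hx
    have hs := X.row_sorted i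
    rw [← List.take_append_drop b (X.row i), List.pairwise_append] at hs
    exact (hs.2.2 x hx z hz).trans hzy

theorem fixesCols_of_right_eq {b : ℕ} {X M N : Tableau} (h : X.right b = M * N) :
    FixesCols b (X.left b * M) N := by
  have hX : X.left b * M * N = X := by rw [mul_assoc, ← h, left_mul_right]
  obtain ⟨h₁, h₂⟩ := glue_left_of_right_eq h
  exact ⟨by rw [hX, h₁], by rw [hX, h₂, h]⟩

theorem left_left {b c : ℕ} (h : b ≤ c) (X : Tableau) : (X.left c).left b = X.left b :=
  row_ext fun i => by simp only [row_left, List.take_take, min_eq_left h]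

theorem right_left (b c : ℕ) (X : Tableau) :
    (X.right b).left (c - b) = (X.left c).right b :=
  row_ext fun i => by simp only [row_left, row_right, List.drop_take]

theorem right_right (b c : ℕ) (X : Tableau) : (X.right b).right c = X.right (b + c) :=
  row_ext fun i => by simp only [row_right, List.drop_drop]

theorem right_eq_mul {b c : ℕ} (h : b ≤ c) (X : Tableau) :
    X.right b = (X.left c).right b * X.right c := by
  conv_lhs => rw [← left_mul_right (c - b) (X.right b)]
  rw [right_left, right_right, Nat.add_sub_cancel' h]

theorem FixesCols.mono {b c : ℕ} (hbc : b ≤ c) {X N : Tableau} (h : FixesCols c X N) :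
    FixesCols b X N := by
  constructor
  · rw [← left_left hbc, h.1, left_left hbc]
  · rw [right_eq_mul hbc (X * N), h.1, h.2, ← mul_assoc, ← right_eq_mul hbc]

theorem FixesCols.right_one {b : ℕ} {X N : Tableau} (h : FixesCols (b + 1) X N) :
    FixesCols b (X.right 1) N := by
  have h₁ := (h.mono (b := 1) (by omega)).2
  have hl : ∀ Y : Tableau, (Y.right 1).left b = (Y.left (b + 1)).right 1 := fun Y => by
    have := right_left 1 (b + 1) Y
    rwa [Nat.add_sub_cancel] at this
  constructor
  · rw [← h₁, hl, h.1, hl]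
  · rw [← h₁, right_right, right_right, add_comm 1 b, h.2]

/-- Allows columns to be treated one at a time, which is how column insertion proceeds. -/
theorem fixesCols_succ {b : ℕ} {X N : Tableau} (h₁ : FixesCols 1 X N)
    (h : FixesCols b (X.right 1) N) : FixesCols (b + 1) X N := by
  have hrow : ∀ (Y : Tableau) i, (Y.row i).take (b + 1) =
      (Y.left 1).row i ++ ((Y.right 1).left b).row i := fun Y i => by
    rw [row_left, row_left, row_right, add_comm b 1, List.take_add]
  constructor
  · refine row_ext fun i => ?_
    rw [row_left, row_left, hrow, hrow, h₁.1, h₁.2, h.1]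
  · rw [add_comm b 1, ← right_right, ← right_right, h₁.2, h.2]

theorem fixesCols_zero (X N : Tableau) : FixesCols 0 X N := by
  constructor <;> refine row_ext fun i => ?_
  · simp [row_left]
  · have : X.right 0 = X := row_ext fun i => by simp [row_right]
    simp [row_right, this]

end Tableau

/-! ### Left multiplication by one letter: column insertion -/

/-- Column-insert `x` into a column. -/
def colBump (x : ℤ) : List ℤ → Option ℤ × List ℤ
  | [] => (none, [x])
  | y :: c => if x ≤ y then (some y, x :: c) else ((colBump x c).1, y :: (colBump x c).2)

theorem mem_colBump {x z : ℤ} : ∀ {c : List ℤ}, z ∈ (colBump x c).2 → z = x ∨ z ∈ c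
  | [], h => by simpa [colBump] using h
  | y :: c, h => by
    by_cases hxy : x ≤ y
    · simp only [colBump, hxy, if_true, List.mem_cons] at h ⊢
      tauto
    · simp only [colBump, hxy, if_false, List.mem_cons] at h ⊢
      rcases h with h | h
      · tauto
      · have := mem_colBump h
        tauto

theorem colBump_sorted {x : ℤ} : ∀ {c : List ℤ}, c.Pairwise (· < ·) →
    (colBump x c).2.Pairwise (· < ·)
  | [], _ => by simp [colBump]
  | y :: c, h => by
    rw [List.pairwise_cons] at h
    by_cases hxy : x ≤ y
    · simp only [colBump, hxy, if_true, List.pairwise_cons]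
      exact ⟨fun z hz => hxy.trans_lt (h.1 z hz), h.2⟩
    · simp only [colBump, hxy, if_false, List.pairwise_cons]
      refine ⟨fun z hz => ?_, colBump_sorted h.2⟩
      rcases mem_colBump hz with rfl | hz
      · exact not_le.1 hxy
      · exact h.1 z hz

theorem colBump_ne_nil (x : ℤ) (c : List ℤ) : (colBump x c).2 ≠ [] := by
  cases c with
  | nil => simp [colBump]
  | cons y c => by_cases h : x ≤ y <;> simp [colBump, h]

theorem le_of_colBump {x q : ℤ} : ∀ {c : List ℤ}, (colBump x c).1 = some q → x ≤ q
  | [], h => by simp [colBump] at h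
  | z :: c, h => by
    by_cases hxz : x ≤ z
    · simp only [colBump, hxz, if_true, Option.some.injEq] at h
      exact h ▸ hxz
    · simp only [colBump, hxz, if_false] at h
      exact le_of_colBump h

theorem dominates_colBump {x : ℤ} : ∀ c : List ℤ, Dominates (colBump x c).2 c
  | [] => dominates_nil _
  | y :: c => by
    by_cases h : x ≤ y
    · simpa [colBump, h, Dominates] using Dominates.refl c
    · simpa [colBump, h, Dominates] using dominates_colBump c

/-- The letter q bumped out of one column enters the next one weakly higher up, where the new entry
of the first column is still at most q. -/
theorem Dominates.colBump {p q : ℤ} : ∀ {c d : List ℤ}, Dominates c d →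
    (colBump p c).1 = some q → Dominates (colBump p c).2 (colBump q d).2
  | [], _, _, h => by simp [FactorSeq.colBump] at h
  | u :: c, d, hcd, h => by
    by_cases hpu : p ≤ u
    · simp only [FactorSeq.colBump, hpu, if_true, Option.some.injEq] at h ⊢
      subst h
      cases d with
      | nil => simp [FactorSeq.colBump, Dominates, hpu, dominates_nil]
      | cons v d => simpa [FactorSeq.colBump, Dominates, hcd.1, hpu] using hcd.2
    · simp only [FactorSeq.colBump, hpu, if_false] at h ⊢
      have huq : u ≤ q := (not_le.1 hpu).le.trans (le_of_colBump h)
      cases d with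
      | nil => simp [FactorSeq.colBump, Dominates, huq, dominates_nil]
      | cons v d =>
        by_cases hqv : q ≤ v
        · simp only [FactorSeq.colBump, hqv, if_true]
          exact ⟨huq, (dominates_colBump c).trans hcd.2⟩
        · simp only [FactorSeq.colBump, hqv, if_false]
          exact ⟨hcd.1, hcd.2.colBump h⟩

theorem insertRows_singletons {x : ℤ} : ∀ {c : List ℤ}, (x :: c).Pairwise (· < ·) →
    insertRows (c.map ([·])) x = (x :: c).map ([·])
  | [], _ => rfl
  | y :: c, h => by
    rw [List.pairwise_cons] at h
    have hxy := h.1 y (by simp)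
    simp [insertRows, bump, hxy, insertRows_singletons h.2]

/-- The column arrives from its largest letter on. Letters ≥ p bump each other down next to p, so
the smallest of them stays in the top row as the second entry; letters < p then only push the first
column down. -/
theorem insertWord_column {p : ℤ} : ∀ {c : List ℤ}, c.Pairwise (· < ·) →
    insertWord [[p]] c.reverse =
      zipAppend ((colBump p c).2.map ([·])) ((colBump p c).1.toList.map ([·]))
  | [], _ => rfl
  | a :: c, h => by
    have h' := List.pairwise_cons.1 h
    have ih := insertWord_column (p := p) h'.2
    rw [List.reverse_cons, insertWord_append, ih]
    change insertRows _ a = _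
    by_cases hpa : p ≤ a
    · cases c with
      | nil => simp [colBump, hpa, insertRows, bump, not_lt.2 hpa, zipAppend]
      | cons d c =>
        have had := h'.1 d (by simp)
        have := insertRows_singletons h'.2
        simp [colBump, hpa, hpa.trans had.le, insertRows, bump, not_lt.2 hpa, zipAppend, had, this]
    · have hs := colBump_sorted (x := p) h'.2
      have hm : ∀ z ∈ (colBump p c).2, a < z := fun z hz => by
        rcases mem_colBump hz with rfl | hz
        · exact not_le.1 hpa
        · exact h'.1 z hz
      simp only [colBump, hpa, if_false]
      cases he : (colBump p c).2 with
      | nil => exact absurd he (colBump_ne_nil p c)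
      | cons e e' =>
        rw [he] at hs hm
        have hae := hm e (by simp)
        have := insertRows_singletons hs
        cases (colBump p c).1 <;> simp [zipAppend, insertRows, bump, hae, this]

namespace Tableau

/-- The tableau with one box. -/
def single (p : ℤ) : Tableau := ⟨[[p]], by simp, by simp, by simp⟩

/-- The entries of the first column. -/
def col (T : Tableau) : List ℤ := T.rows.map List.headI

theorem getElem?_col (T : Tableau) (i : ℕ) : T.col[i]? = (T.row i).head? := by
  rw [col, List.getElem?_map, row, List.getD_eq_getElem?_getD]
  cases h : T.rows[i]? with
  | none => rfl
  | some r =>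
    have := T.isTableau.ne_nil r (List.mem_of_getElem? h)
    cases r with
    | nil => exact absurd rfl this
    | cons x r => rfl

theorem rows_left_one (T : Tableau) : (T.left 1).rows = T.col.map ([·]) := by
  have h : T.rows.map (List.take 1) = T.col.map ([·]) := by
    rw [col, List.map_map]
    refine List.map_congr_left fun r hr => ?_
    have := T.isTableau.ne_nil r hr
    cases r with
    | nil => exact absurd rfl this
    | cons x r => rfl
  change List.filter _ (T.rows.map (List.take 1)) = _
  rw [h, List.filter_eq_self]
  simp

theorem col_sorted (T : Tableau) : T.col.Pairwise (· < ·) := by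
  have h := (T.left 1).isTableau.pairwise
  rw [rows_left_one, List.pairwise_map] at h
  exact h.imp fun h => h.1

theorem col_left_one (T : Tableau) : (T.left 1).col = T.col := by
  rw [col, rows_left_one, List.map_map]
  exact List.map_id _

theorem dominates_col (T : Tableau) : Dominates T.col (T.right 1).col := by
  rw [dominates_iff_getElem?]
  intro i y hy
  rw [getElem?_col, row_right] at hy
  rw [getElem?_col]
  have hs := T.row_sorted i
  cases h : T.row i with
  | nil => simp [h] at hy
  | cons x r =>
    rw [h] at hs hy
    exact ⟨x, rfl, (List.pairwise_cons.1 hs).1 y (List.mem_of_mem_head? hy)⟩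

theorem rows_single_mul (p : ℤ) (X : Tableau) :
    (single p * X.left 1).rows = zipAppend ((colBump p X.col).2.map ([·]))
      ((colBump p X.col).1.toList.map ([·])) := by
  rw [rows_mul, word, rows_left_one, ← List.map_reverse, ← List.flatMap_def,
    List.flatMap_singleton']
  exact insertWord_column X.col_sorted

theorem row_single_mul (p : ℤ) (X : Tableau) (i : ℕ) :
    (single p * X.left 1).row i = (colBump p X.col).2[i]?.toList ++
      (colBump p X.col).1.toList[i]?.toList := by
  rw [row, rows_single_mul, getD_zipAppend]
  simp only [List.getD_eq_getElem?_getD, List.getElem?_map]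
  congr 1
  · cases (colBump p X.col).2[i]? <;> rfl
  · cases (colBump p X.col).1.toList[i]? <;> rfl

theorem row_left_single_mul (p : ℤ) (X : Tableau) (i : ℕ) :
    ((single p * X.left 1).left 1).row i = (colBump p X.col).2[i]?.toList := by
  rw [row_left, row_single_mul]
  cases h : (colBump p X.col).2[i]? with
  | some x => rfl
  | none =>
    cases i with
    | zero =>
      have := colBump_ne_nil p X.col
      simp_all
    | succ i => cases (colBump p X.col).1 <;> simp

theorem row_right_single_mul (p : ℤ) (X : Tableau) (i : ℕ) :
    ((single p * X.left 1).right 1).row i = (colBump p X.col).1.toList[i]?.toList := by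
  rw [row_right, row_single_mul]
  cases h : (colBump p X.col).2[i]? with
  | some x => rfl
  | none =>
    cases i with
    | zero =>
      have := colBump_ne_nil p X.col
      simp_all
    | succ i => cases (colBump p X.col).1 <;> simp

theorem col_single_mul (p : ℤ) (X : Tableau) :
    (single p * X.left 1).col = (colBump p X.col).2 := by
  rw [← col_left_one]
  refine List.ext_getElem? fun i => ?_
  rw [getElem?_col, row_left_single_mul]
  cases (colBump p X.col).2[i]? <;> rfl

/-- The hypothesis says that the new first column fits to the left of what remains; gluing the two
then identifies the first column of the product. -/
theorem fixesCols_of_dominates {p : ℤ} {X : Tableau}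
    (h : Dominates (colBump p X.col).2 ((single p * X.left 1).right 1 * X.right 1).col) :
    FixesCols 1 (single p * X.left 1) (X.right 1) := by
  set K := single p * X.left 1 with hK
  have hd : ∀ i y, y ∈ (K.right 1 * X.right 1).row i →
      ∃ x, (colBump p X.col).2[i]? = some x ∧ x ≤ y := by
    intro i y hy
    have hs := (K.right 1 * X.right 1).row_sorted i
    cases hr : (K.right 1 * X.right 1).row i with
    | nil => simp [hr] at hy
    | cons z r =>
      obtain ⟨x, hx, hxz⟩ := dominates_iff_getElem?.1 h i z (by rw [getElem?_col, hr]; rfl)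
      rw [hr] at hy hs
      refine ⟨x, hx, hxz.trans ?_⟩
      rcases List.mem_cons.1 hy with rfl | hy
      · exact le_rfl
      · exact (List.pairwise_cons.1 hs).1 y hy
  have hg := glue (b := 1) (A := K.left 1) (B := K.right 1 * X.right 1)
    (fun i => by rw [row_left]; exact List.length_take_le _ _) (fun i hi => by
      obtain ⟨y, hy⟩ := List.exists_mem_of_ne_nil _ hi
      obtain ⟨x, hx, -⟩ := hd i y hy
      rw [hK, row_left_single_mul, hx]
      simp) (fun i x hx y hy => by
      obtain ⟨z, hz, hzy⟩ := hd i y hy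
      rw [hK, row_left_single_mul, hz] at hx
      simp only [Option.toList_some, List.mem_singleton] at hx
      exact hx ▸ hzy)
  rw [← mul_assoc, left_mul_right] at hg
  exact hg

/-- Left multiplication by a letter is column insertion: p enters the first column, and the letter
bumped out multiplies the remaining columns from the left. Induction on the number of columns
describes the next column, and the two columns remain compatible. -/
theorem fixesCols_single_mul_left_one (p : ℤ) (X : Tableau) :
    FixesCols 1 (single p * X.left 1) (X.right 1) := by
  obtain ⟨m, hm⟩ : ∃ m, (X.row 0).length ≤ m := ⟨_, le_rfl⟩
  induction m generalizing p X with
  | zero =>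
    have hX : X = ∅ := row_ext fun i => by
      have := X.row_length_anti (Nat.zero_le i)
      rw [row_empty, ← List.length_eq_zero_iff]
      omega
    have hR : X.right 1 = ∅ := row_ext fun i => by simp [hX, row_right]
    constructor <;> simp [hR]
  | succ m ih =>
    apply fixesCols_of_dominates
    cases hq : (colBump p X.col).1 with
    | none =>
      have : (single p * X.left 1).right 1 = ∅ := row_ext fun i => by
        simp [row_right_single_mul, hq]
      rw [this, empty_mul']
      exact (dominates_colBump _).trans X.dominates_col
    | some q =>
      have : (single p * X.left 1).right 1 = single q := row_ext fun i => by
        rw [row_right_single_mul, hq]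
        cases i <;> simp [row, single]
      rw [this]
      have ih' := (ih q (X.right 1) (by rw [row_right, List.length_drop]; omega)).1
      rw [mul_assoc, left_mul_right] at ih'
      rw [← col_left_one (single q * _), ih', col_left_one, col_single_mul]
      exact X.dominates_col.colBump hq

theorem single_mul_left_one (p : ℤ) (X : Tableau) :
    (single p * X).left 1 = (single p * X.left 1).left 1 := by
  have := (fixesCols_single_mul_left_one p X).1
  rwa [mul_assoc, left_mul_right] at this

theorem single_mul_right_one (p : ℤ) (X : Tableau) :
    (single p * X).right 1 = (single p * X.left 1).right 1 * X.right 1 := by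
  have := (fixesCols_single_mul_left_one p X).2
  rwa [mul_assoc, left_mul_right] at this

theorem FixesCols.single_mul {X N : Tableau} (p : ℤ) (h : FixesCols 1 X N) :
    FixesCols 1 (single p * X) N := by
  constructor
  · rw [mul_assoc, single_mul_left_one, single_mul_left_one p X, h.1]
  · rw [mul_assoc, single_mul_right_one, single_mul_right_one p X, h.1, h.2, mul_assoc]

/-- Every tableau is a product of letters. -/
theorem induction_single_mul {motive : Tableau → Prop} (empty : motive ∅)
    (single_mul : ∀ p P, motive P → motive (single p * P)) (P : Tableau) : motive P := by
  have h : ∀ w : List ℤ, ∀ Q : Tableau, Q.rows = insertWord [] w → motive Q := by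
    intro w
    induction w with
    | nil => exact fun Q hQ => (Tableau.ext hQ : Q = ∅) ▸ empty
    | cons x w ih =>
      intro Q hQ
      have hI : IsTableau (insertWord [] w) := (∅ : Tableau).isTableau.insertWord w
      have : Q = single x * ⟨insertWord [] w, hI⟩ := by
        ext1
        rw [hQ, rows_mul]
        exact (knuthEq_insertWord (rs := []) (∅ : Tableau).isTableau w).insertWord_eq
          (single x).isTableau
      rw [this]
      exact single_mul _ _ (ih _ rfl)
  refine h P.word P ?_
  have := rows_mul ∅ P
  rwa [empty_mul'] at this

/-- Column insertion of a letter into X and into X·N agrees on the common first b columns and bumps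
out the same letters, so N stays a right factor of what lies beyond. The induction is on b, and
inside it on the letters of P. -/
theorem FixesCols.mul_left {b : ℕ} {X N : Tableau} (h : FixesCols b X N) (P : Tableau) :
    FixesCols b (P * X) N := by
  induction b generalizing X P with
  | zero => exact fixesCols_zero _ _
  | succ b ih =>
    induction P using induction_single_mul with
    | empty => rwa [empty_mul']
    | single_mul p P ihP =>
      rw [mul_assoc]
      refine fixesCols_succ ((ihP.mono (by omega)).single_mul p) ?_
      rw [single_mul_right_one]
      -- The remaining columns of p·(P·X) are those of P·X times the letter bumped from the first
      -- column, if any; that is the left factor used here.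
      exact ih ihP.right_one _

end Tableau
end FactorSeq

/-! ### Passing a word through a block of rows -/

namespace FactorSeq

/-- Insert a word into the rows of `rs`, collecting the letters bumped out of the last row. -/
def bumpRows : List (List ℤ) → List ℤ → List (List ℤ) × List ℤ
  | [], w => ([], w)
  | r :: rs, w => ((bumpWord r w).2 :: (bumpRows rs (bumpWord r w).1).1,
      (bumpRows rs (bumpWord r w).1).2)

theorem insertWord_append_rows (rs ss : List (List ℤ)) (w : List ℤ) :
    insertWord (rs ++ ss) w = (bumpRows rs w).1 ++ insertWord ss (bumpRows rs w).2 := by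
  induction rs generalizing w with
  | nil => rfl
  | cons r rs ih => rw [List.cons_append, insertWord_cons, ih, bumpRows, List.cons_append]

theorem length_bumpRows (rs : List (List ℤ)) (w : List ℤ) :
    (bumpRows rs w).1.length = rs.length := by
  induction rs generalizing w with
  | nil => rfl
  | cons r rs ih => simp [bumpRows, ih]

namespace Tableau

/-! ### Left factors that leave the first rows alone -/

/-- Multiplying `Y` by `M` from the left does not affect the first `a` rows of `Y`. -/
def FixesRows (a : ℕ) (M Y : Tableau) : Prop :=
  (M * Y).top a = Y.top a ∧ (M * Y).below a = M * Y.below a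

theorem mul_eq_empty {M N : Tableau} (h : M * N = ∅) : M = ∅ ∧ N = ∅ := by
  have : ∀ x, ¬ (M * N).HasEntry x := by
    rw [h]
    rintro x ⟨r, hr, -⟩
    exact absurd hr (by simp [EmptyCollection.emptyCollection])
  simp only [hasEntry_mul, not_or] at this
  exact ⟨eq_empty_of_forall_not_hasEntry fun x => (this x).1,
    eq_empty_of_forall_not_hasEntry fun x => (this x).2⟩

theorem rows_empty : (∅ : Tableau).rows = [] := rfl

theorem rows_top_append_rows_below (a : ℕ) (Y : Tableau) :
    (Y.top a).rows ++ (Y.below a).rows = Y.rows := List.take_append_drop a Y.rows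

/-- The first row of M·N is entrywise at most that of N, so N can hang below the first a rows of Y
whenever M·N does. -/
theorem rows_mul_top_of_below_eq {a : ℕ} {Y M N : Tableau} (h : Y.below a = M * N) :
    (N * Y.top a).rows = (Y.top a).rows ++ N.rows := by
  refine rows_mul_of_isTableau ⟨?_, ?_, ?_⟩
  · intro r hr
    rcases List.mem_append.1 hr with hr | hr
    · exact (Y.top a).isTableau.ne_nil r hr
    · exact N.isTableau.ne_nil r hr
  · intro r hr
    rcases List.mem_append.1 hr with hr | hr
    · exact (Y.top a).isTableau.row_weak r hr
    · exact N.isTableau.row_weak r hr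
  · have hc := Y.isTableau.col_strict
    rw [← rows_top_append_rows_below a, List.isChain_append] at hc
    refine List.isChain_append.2 ⟨hc.1, N.isTableau.col_strict, fun x hx y hy => ?_⟩
    have hd := dominates_row_zero_mul M N
    rw [← h, row, row] at hd
    cases hN : N.rows with
    | nil => simp [hN] at hy
    | cons n N' =>
      rw [hN] at hy hd
      obtain rfl : n = y := by simpa using hy
      have hn : n ≠ [] := N.isTableau.ne_nil n (by simp [hN])
      cases hB : (Y.below a).rows with
      | nil =>
        rw [hB] at hd
        cases n with
        | nil => exact absurd rfl hn
        | cons => simp [Dominates] at hd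
      | cons k K =>
        rw [hB] at hd hc
        exact (hc.2.2 x hx k (by simp)).dominates (by simpa using hd)

theorem fixesRows_of_below_eq {a : ℕ} {Y M N : Tableau} (h : Y.below a = M * N) :
    FixesRows a M (N * Y.top a) := by
  have hY : M * (N * Y.top a) = Y := by rw [← mul_assoc, ← h, below_mul_top]
  have hr := rows_mul_top_of_below_eq h
  have key : (N * Y.top a).top a = Y.top a ∧ (N * Y.top a).below a = N := by
    rcases le_or_gt a Y.rows.length with hl | hl
    · have hl' : (Y.top a).rows.length = a := by simp [top, hl]
      constructor <;> ext1
      · change (N * Y.top a).rows.take a = _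
        rw [hr, List.take_left' hl']
      · change (N * Y.top a).rows.drop a = _
        rw [hr, List.drop_left' hl']
    · have hb : Y.below a = ∅ := by
        ext1
        change Y.rows.drop a = []
        rw [List.drop_eq_nil_iff]
        exact hl.le
      rw [hb] at h
      obtain ⟨-, rfl⟩ := mul_eq_empty h.symm
      rw [empty_mul']
      constructor <;> refine row_ext fun i => ?_
      · rw [row_top, row_top]
        split_ifs <;> rfl
      · rw [row_below, row_top]
        simp
  refine ⟨by rw [hY, key.1], by rw [hY, key.2, h]⟩

/-- Row insertion treats the first a rows without regard to the rows below. The words leaving these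
rows are the same for Y and M·Y, and they are inserted into `Y.below a` and M times it;
associativity concludes. -/
theorem FixesRows.mul_right {a : ℕ} {M Y : Tableau} (h : FixesRows a M Y) (P : Tableau) :
    FixesRows a M (Y * P) := by
  rcases le_or_gt a Y.rows.length with hl | hl
  · have hlen : (Y.top a).rows.length = a := by simp [top, hl]
    have h₁ : (Y * P).rows = (bumpRows (Y.top a).rows P.word).1 ++
        insertWord (Y.below a).rows (bumpRows (Y.top a).rows P.word).2 := by
      rw [rows_mul, ← rows_top_append_rows_below a Y, insertWord_append_rows]
    have h₂ : (M * (Y * P)).rows = (bumpRows (Y.top a).rows P.word).1 ++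
        insertWord (M * Y.below a).rows (bumpRows (Y.top a).rows P.word).2 := by
      rw [← mul_assoc, rows_mul, ← rows_top_append_rows_below a (M * Y), insertWord_append_rows,
        h.1, h.2]
    have hlen' : (bumpRows (Y.top a).rows P.word).1.length = a := by rw [length_bumpRows, hlen]
    constructor <;> ext1
    · change (M * (Y * P)).rows.take a = (Y * P).rows.take a
      rw [h₁, h₂, List.take_left' hlen', List.take_left' hlen']
    · change (M * (Y * P)).rows.drop a = _
      rw [h₂, List.drop_left' hlen', rows_mul, rows_mul, ← insertWord_append]
      have h₃ : ((Y * P).below a).rows =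
          insertWord (Y.below a).rows (bumpRows (Y.top a).rows P.word).2 := by
        change (Y * P).rows.drop a = _
        rw [h₁, List.drop_left' hlen']
      unfold word at h₃ ⊢
      rw [h₃]
      exact (knuthEq_insertWord (Y.below a).isTableau _).insertWord_eq M.isTableau
  -- If Y has fewer than a rows, then so has M·Y, and nothing is left for M.
  · have hM : M = ∅ := by
      have h₁ := congrArg (fun T => T.rows.length) h.1
      simp only [top, List.length_take] at h₁
      have h₂ : (M * Y).below a = ∅ := by
        ext1
        change (M * Y).rows.drop a = []
        rw [List.drop_eq_nil_iff]
        omega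
      exact (mul_eq_empty (h.2.symm.trans h₂)).1
    subst hM
    constructor <;> simp

theorem top_top {a c : ℕ} (h : a ≤ c) (Y : Tableau) : (Y.top c).top a = Y.top a :=
  row_ext fun i => by
    simp only [row_top]
    split_ifs <;> first | rfl | omega

theorem below_eq_mul {a c : ℕ} (h : a ≤ c) (Y : Tableau) :
    Y.below a = Y.below c * (Y.top c).below a := by
  conv_lhs => rw [← below_mul_top (c - a) (Y.below a)]
  congr 1 <;> refine row_ext fun i => ?_
  · rw [row_below, row_below, row_below]
    congr 1
    omega
  · rw [row_below, row_top, row_top, row_below]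
    split_ifs <;> first | rfl | omega

theorem FixesRows.mono {a c : ℕ} (hac : a ≤ c) {M Y : Tableau} (h : FixesRows c M Y) :
    FixesRows a M Y := by
  constructor
  · rw [← top_top hac, h.1, top_top hac]
  · rw [below_eq_mul hac (M * Y), h.1, h.2, mul_assoc, ← below_eq_mul hac]

/-! ### Multiplication by a rectangular tableau with small entries -/

/-- All entries of `T` are strictly smaller than all entries of `X`. -/
def Smaller (T X : Tableau) : Prop := ∀ t, T.HasEntry t → ∀ x, X.HasEntry x → t < x

theorem Smaller.mul {T X Y : Tableau} (hX : Smaller T X) (hY : Smaller T Y) :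
    Smaller T (X * Y) := fun t ht x hx => by
  rcases hasEntry_mul.1 hx with hx | hx
  · exact hX t ht x hx
  · exact hY t ht x hx

theorem IsRect.length_row {a b : ℕ} {T : Tableau} (h : T.IsRect a b) (i : ℕ) :
    (T.row i).length = if i < a then b else 0 := h i

theorem IsRect.row_eq_nil {a b : ℕ} {T : Tableau} (h : T.IsRect a b) {i : ℕ} (hi : a ≤ i) :
    T.row i = [] := by
  rw [← List.length_eq_zero_iff, h.length_row, if_neg (not_lt.2 hi)]

theorem Smaller.row_le {T Y : Tableau} (h : Smaller T Y) (i : ℕ) :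
    ∀ x ∈ T.row i, ∀ y ∈ Y.row i, x ≤ y := fun x hx y hy =>
  (h x (hasEntry_iff_row.2 ⟨i, hx⟩) y (hasEntry_iff_row.2 ⟨i, hy⟩)).le

/-- With small entries in T, the product T·Y just appends the rows of Y to those of T; from row a on
there is only Y. -/
theorem IsRect.mul_eq {a b : ℕ} {T Y : Tableau} (hT : T.IsRect a b) (h : Smaller T Y) :
    T * Y = Y.below a * T * Y.top a := by
  have h' : Smaller T (Y.top a) := fun t ht x hx => h t ht x (hasEntry_of_top hx)
  rw [mul_assoc, ← below_mul_top a (T * Y)]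
  congr 1 <;> refine row_ext fun i => ?_
  · rw [row_below, row_below, row_mul_of_le h.row_le, hT.row_eq_nil (by omega), List.nil_append]
  · rw [row_top, row_mul_of_le h.row_le, row_mul_of_le h'.row_le, row_top]
    split_ifs with hi
    · rfl
    · rw [hT.row_eq_nil (by omega)]
      rfl

end Tableau

/-- Here the left-hand part is pushed down and the right-hand part stays. Equal lengths, in every
row that has a right-hand part, ensure that a row coming down replaces exactly the row it displaces.
-/
theorem insertWord_zipAppend_cons : ∀ {ls rs : List (List ℤ)} {t : List ℤ},
    IsTableau (t :: ls) →
    (∀ i < rs.length, ((t :: ls).getD i []).length = (ls.getD i []).length) →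
    insertWord (zipAppend ls rs) t = zipAppend (t :: ls) rs
  | [], [], t, ht, _ => by
    have := bumpWord_of_above (u := []) (s := []) (v := []) (ht.row_weak t (by simp)) (by simp)
      (above_nil t) (.inr rfl)
    simp only [List.nil_append, List.append_nil] at this
    simp [zipAppend, insertWord_nil (ht.ne_nil t (by simp)), this]
  | [], r :: rs, t, ht, h => by
    have := h 0 (by simp)
    exact absurd (by simpa using this) (ht.ne_nil t (by simp))
  | l :: ls, [], t, ht, _ => by
    have := bumpWord_of_above (u := []) (s := l) (v := []) (ht.row_weak t (by simp)) (by simp)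
      (List.isChain_cons_cons.1 ht.col_strict).1 (.inr rfl)
    simp only [List.nil_append, List.append_nil] at this
    have ih := insertWord_zipAppend_cons (rs := []) ht.tail (by simp)
    simp only [zipAppend_nil] at ih ⊢
    rw [insertWord_cons, this, ih]
  | l :: ls, r :: rs, t, ht, h => by
    have := bumpWord_of_above (u := []) (s := l) (v := r) (ht.row_weak t (by simp)) (by simp)
      (List.isChain_cons_cons.1 ht.col_strict).1 (.inl (by simpa using h 0 (by simp)))
    simp only [List.nil_append] at this
    have ih := insertWord_zipAppend_cons (rs := rs) ht.tail fun i hi => by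
      simpa using h (i + 1) (by simpa using hi)
    rw [zipAppend, insertWord_cons, this, ih]
    rfl

theorem insertWord_zipAppend_stack {b : ℕ} {ls rs : List (List ℤ)}
    (hb : ∀ i < rs.length, (ls.getD i []).length = b) : ∀ {ts : List (List ℤ)},
    IsTableau (ts ++ ls) → (∀ t ∈ ts, t.length = b) →
    insertWord (zipAppend ls rs) ts.reverse.flatten = zipAppend (ts ++ ls) rs
  | [], _, _ => rfl
  | t :: ts, h, ht => by
    have ih := insertWord_zipAppend_stack hb (ts := ts) h.tail fun s hs => ht s (by simp [hs])
    rw [List.reverse_cons, List.flatten_append, insertWord_append, ih, List.flatten_singleton]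
    refine insertWord_zipAppend_cons h ?_
    have key : ∀ (us : List (List ℤ)), (∀ u ∈ us, u.length = b) → ∀ i < rs.length,
        ((us ++ ls).getD i []).length = b := by
      intro us hus i hi
      rcases lt_or_ge i us.length with h' | h'
      · rw [List.getD_append _ _ _ _ h', List.getD_eq_getElem _ _ h']
        exact hus _ (List.getElem_mem h')
      · rw [List.getD_append_right _ _ _ _ h']
        exact hb _ (by omega)
    intro i hi
    rw [← List.cons_append, key (t :: ts) ht i hi, key ts (fun s hs => ht s (by simp [hs])) i hi]

namespace Tableau

/-- Inserting T pushes the first b columns of X down under T and leaves the other columns where they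
are. The result is the stack of T on `X.left b` with `X.right b` beside it. -/
theorem IsRect.mul_eq' {a b : ℕ} {X T : Tableau} (hT : T.IsRect a b) (h : Smaller T X) :
    X * T = X.left b * T * X.right b := by
  by_cases hT0 : T.rows = []
  · obtain rfl : T = ∅ := Tableau.ext hT0
    rw [mul_empty', mul_empty', left_mul_right]
  have hlen : ∀ t ∈ T.rows, t.length = b := fun t ht => by
    obtain ⟨i, hi, rfl⟩ := List.getElem_of_mem ht
    have h₁ := hT.length_row i
    have h₂ := row_ne_nil hi
    rw [row, List.getD_eq_getElem _ _ hi] at h₁ h₂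
    rw [← List.length_pos_iff, h₁] at h₂
    rw [h₁]
    split_ifs at h₂ ⊢
    · rfl
    · omega
  have hX : X.rows = zipAppend (X.left b).rows (X.right b).rows := by
    conv_lhs => rw [← left_mul_right b X]
    refine rows_mul_of_le fun i x hx y hy => ?_
    rw [row_left] at hx
    rw [row_right] at hy
    have h := X.row_sorted i
    rw [← List.take_append_drop b (X.row i), List.pairwise_append] at h
    exact h.2.2 x hx y hy
  have hstack : IsTableau (T.rows ++ (X.left b).rows) := by
    refine ⟨?_, ?_, List.isChain_append.2 ⟨T.isTableau.col_strict, (X.left b).isTableau.col_strict,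
      fun t ht x hx => ?_⟩⟩
    · intro r hr
      rcases List.mem_append.1 hr with hr | hr
      · exact T.isTableau.ne_nil r hr
      · exact (X.left b).isTableau.ne_nil r hr
    · intro r hr
      rcases List.mem_append.1 hr with hr | hr
      · exact T.isTableau.row_weak r hr
      · exact (X.left b).isTableau.row_weak r hr
    · have ht' := List.mem_of_mem_getLast? ht
      have hx' := List.mem_of_mem_head? hx
      refine above_of_forall_lt ?_ fun u hu v hv =>
        h u ⟨t, ht', hu⟩ v (hasEntry_of_left ⟨x, hx', hv⟩)
      rw [hlen t ht']
      obtain ⟨r, -, rfl⟩ := List.mem_map.1 (List.mem_filter.1 hx').1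
      exact List.length_take_le _ _
  have hb : ∀ i < (X.right b).rows.length, ((X.left b).rows.getD i []).length = b := by
    intro i hi
    have h₁ := row_ne_nil hi
    rw [row_right, ← List.length_pos_iff, List.length_drop] at h₁
    change ((X.left b).row i).length = b
    rw [row_left, List.length_take]
    omega
  have hXT : (X * T).rows = zipAppend (T.rows ++ (X.left b).rows) (X.right b).rows := by
    rw [rows_mul, hX]
    exact insertWord_zipAppend_stack hb hstack hlen
  have hle : ∀ i, ∀ x ∈ (X.left b * T).row i, ∀ y ∈ (X.right b).row i, x ≤ y := by
    intro i x hx y hy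
    rw [row, rows_mul_of_isTableau hstack] at hx
    rcases lt_or_ge i T.rows.length with h' | h'
    · rw [List.getD_append _ _ _ _ h'] at hx
      exact (h x (hasEntry_iff_row.2 ⟨i, hx⟩) y
        (hasEntry_of_right (hasEntry_iff_row.2 ⟨i, hy⟩))).le
    · rw [List.getD_append_right _ _ _ _ h'] at hx
      -- A pushed-down entry is compared with the right part in its old, higher row, whose entries
      -- bound those below in the same column.
      obtain ⟨z, hz, hzy⟩ := (X.right b).exists_le_of_mem_row (Nat.sub_le i T.rows.length) hy
      rw [row_right] at hz
      change x ∈ (X.left b).row _ at hx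
      rw [row_left] at hx
      have hs := X.row_sorted (i - T.rows.length)
      rw [← List.take_append_drop b (X.row _), List.pairwise_append] at hs
      exact (hs.2.2 x hx z hz).trans hzy
  ext1
  rw [hXT, rows_mul_of_le hle, rows_mul_of_isTableau hstack]

end Tableau

/-! ### Insertion and the first columns -/

/-- The number of boxes in the first `b` columns. -/
def leftSize (b : ℕ) (rs : List (List ℤ)) : ℕ := (rs.map fun r => min b r.length).sum

/-- Bumping routes move weakly left: y leaves one of the first b columns, and the entry directly
below it is larger. -/
theorem exists_lt_of_bump {x y : ℤ} : ∀ {b : ℕ} {r s : List ℤ}, (bump x r).1 = some y →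
    ¬ (b ≤ r.length ∧ ∀ z ∈ r.take b, z ≤ x) → Above r s → b ≤ s.length →
    ∃ z ∈ s.take b, y < z
  | 0, _, _, _, h, _, _ => by simp at h
  | _ + 1, _, [], _, _, _, hb => by simp at hb
  | _ + 1, [], _ :: _, h, _, _, _ => by simp [bump] at h
  | b + 1, a :: r, v :: s, h, hn, hrs, hb => by
    by_cases hxa : x < a
    · simp only [bump, hxa, if_true, Option.some.injEq] at h
      exact ⟨v, by simp, h ▸ hrs.1⟩
    · simp only [bump, hxa, if_false] at h
      obtain ⟨z, hz, hyz⟩ := exists_lt_of_bump (b := b) h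
        (fun hc => hn ⟨by simpa using hc.1, by simpa [not_lt.1 hxa] using hc.2⟩) hrs.2
        (by simpa using hb)
      exact ⟨z, by simp [hz], hyz⟩

theorem length_bump_of_some {x y : ℤ} : ∀ {r : List ℤ}, (bump x r).1 = some y →
    (bump x r).2.length = r.length
  | [], h => by simp [bump] at h
  | z :: r, h => by
    by_cases hxz : x < z
    · simp [bump, hxz]
    · simp only [bump, hxz, if_false] at h ⊢
      simp [length_bump_of_some h]

theorem leftSize_insertRows {b : ℕ} (hb : 0 < b) : ∀ {rs : List (List ℤ)} {x : ℤ},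
    IsTableau rs → (∀ r ∈ rs.head?, ¬ (b ≤ r.length ∧ ∀ z ∈ r.take b, z ≤ x)) →
    leftSize b (insertRows rs x) = leftSize b rs + 1
  | [], x, _, _ => by
    simp only [insertRows, leftSize, List.map_cons, List.map_nil, List.sum_cons, List.sum_nil,
      List.length_singleton]
    omega
  | r :: rs, x, h, hn => by
    have hn' := hn r (by simp)
    cases hx : (bump x r).1 with
    | none =>
      obtain ⟨h₁, h₂⟩ := bump_eq_none hx
      have hl : r.length < b := by
        by_contra hl
        exact hn' ⟨not_lt.1 hl, fun z hz => h₂ z (List.mem_of_mem_take hz)⟩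
      simp only [insertRows, hx, h₁, leftSize, List.map_cons, List.sum_cons, List.length_append,
        List.length_singleton]
      omega
    | some y =>
      have ih := leftSize_insertRows hb (x := y) h.tail fun s hs hc => by
        obtain ⟨z, hz, hyz⟩ := exists_lt_of_bump hx hn'
          ((List.isChain_cons.1 h.col_strict).1 s hs) hc.1
        exact absurd (hc.2 z hz) (not_le.2 hyz)
      unfold leftSize at ih ⊢
      simp only [insertRows, hx, List.map_cons, List.sum_cons, length_bump_of_some hx, ih]
      omega

/-- A bumping route that stays beyond column b is the route of the same insertion into the right
part. Once it enters the first b columns it never leaves them, so the new box lies there. -/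
theorem insertRows_left_right {b : ℕ} : ∀ {rs : List (List ℤ)} {x : ℤ}, IsTableau rs →
    (∀ i, ((insertRows rs x).getD i []).take b = (rs.getD i []).take b ∧
      ((insertRows rs x).getD i []).drop b =
        (insertRows ((rs.map (List.drop b)).filter (fun r => !r.isEmpty)) x).getD i []) ∨
    leftSize b (insertRows rs x) = leftSize b rs + 1
  | [], x, h => by
    rcases Nat.eq_zero_or_pos b with rfl | hb
    · left
      simp
    · right
      exact leftSize_insertRows hb h (by simp)
  | r :: rs, x, h => by
    by_cases hr : b ≤ r.length ∧ ∀ z ∈ r.take b, z ≤ x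
    swap
    · right
      refine leftSize_insertRows ?_ h (by simpa using hr)
      rcases Nat.eq_zero_or_pos b with rfl | hb
      · simp at hr
      · exact hb
    have hlu : (r.take b).length = b := by simp [hr.1]
    have hbump := bump_append hr.2 (r.drop b)
    rw [List.take_append_drop] at hbump
    have hfilter : ∀ i, ((rs.map (List.drop b)).filter (fun r => !r.isEmpty)).getD i [] =
        (rs.getD i []).drop b := fun i => by
      rw [getD_filter_of_pairwise_above
        (List.pairwise_map.2 (h.tail.pairwise.imp fun h => h.drop b))]
      simp only [List.getD_eq_getElem?_getD, List.getElem?_map]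
      cases rs[i]? <;> simp
    by_cases hv : r.drop b = []
    · left
      rw [hv] at hbump
      have hnil : (rs.map (List.drop b)).filter (fun r => !r.isEmpty) = [] := by
        rw [List.filter_eq_nil_iff]
        intro s hs
        obtain ⟨s, hs', rfl⟩ := List.mem_map.1 hs
        have := ((List.pairwise_cons.1 h.pairwise).1 s hs').length_le
        rw [List.drop_eq_nil_iff] at hv
        simp
        omega
      intro i
      have hd := hfilter
      rw [hnil] at hd
      cases i with
      | zero => simp [insertRows, hbump, bump, hv, hnil, hlu]
      | succ i =>
        simpa [insertRows, hbump, bump, hv, hnil] using (hd i).symm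
    · have hfc : ((r :: rs).map (List.drop b)).filter (fun r => !r.isEmpty) =
          r.drop b :: (rs.map (List.drop b)).filter (fun r => !r.isEmpty) := by
        rw [List.map_cons, List.filter_cons_of_pos (by simpa using hv)]
      rw [hfc]
      cases hx : (bump x (r.drop b)).1 with
      | none =>
        left
        intro i
        cases i with
        | zero =>
          simp [insertRows, hbump, hx, hlu]
        | succ i =>
          have := (hfilter i).symm
          simpa [insertRows, hbump, hx] using this
      | some y =>
        rcases insertRows_left_right (b := b) (x := y) h.tail with ih | ih
        · left
          intro i
          cases i with
          | zero =>
            simp [insertRows, hbump, hx, hlu]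
          | succ i => simpa [insertRows, hbump, hx] using ih i
        · right
          have hl := length_bump_of_some (x := x) (r := r) (y := y) (by rw [hbump, hx])
          unfold leftSize at ih ⊢
          rw [insertRows]
          simp only [hbump, hx] at hl ⊢
          simp only [List.map_cons, List.sum_cons, ih, hl]
          omega

namespace Tableau

theorem length_word_left (b : ℕ) (X : Tableau) :
    (X.left b).word.length = leftSize b X.rows := by
  have : ∀ rs : List (List ℤ),
      ((rs.map (List.take b)).filter (fun r => !r.isEmpty)).flatten.length = leftSize b rs := by
    intro rs
    rw [List.flatten_filter_not_isEmpty]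
    simp [leftSize, List.length_flatten, Function.comp_def]
  rw [← this, word, List.Perm.length_eq (List.reverse_perm _).flatten]
  rfl

theorem fixesCols_single_or_lt (b : ℕ) (X : Tableau) (x : ℤ) :
    FixesCols b X (single x) ∨
      (X.left b).word.length < ((X * single x).left b).word.length := by
  rcases insertRows_left_right (b := b) (x := x) X.isTableau with h | h
  · left
    constructor <;> refine row_ext fun i => ?_
    · rw [row_left, row_left]
      exact (h i).1
    · rw [row_right]
      exact (h i).2
  · right
    rw [length_word_left, length_word_left]
    exact (Nat.lt_succ_self _).trans_eq h.symm

/-- The sizes of the first b columns never decrease while the letters of N are inserted, so either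
every letter leaves them alone or they grow. The growth is the termination measure in
`IsRect.reaches`. -/
theorem fixesCols_or_lt (b : ℕ) (X N : Tableau) :
    FixesCols b X N ∨ (X.left b).word.length < ((X * N).left b).word.length := by
  induction N using induction_single_mul generalizing X with
  | empty =>
    left
    constructor <;> simp
  | single_mul p N ih =>
    rw [← mul_assoc]
    rcases fixesCols_single_or_lt b X p with h | h <;> rcases ih (X * single p) with h' | h'
    · left
      constructor
      · rw [← mul_assoc, h'.1, h.1]
      · rw [← mul_assoc, h'.2, h.2, mul_assoc]
    · right
      rwa [h.1] at h'
    · right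
      rwa [h'.1]
    · exact .inr (h.trans h')

end Tableau
end FactorSeq

/-! ### Products around a rectangle with small entries -/

namespace FactorSeq
namespace Tableau

theorem right_left_self (b : ℕ) (X : Tableau) : (X.left b).right b = ∅ :=
  row_ext fun i => by
    rw [row_right, row_left, row_empty, List.drop_eq_nil_of_le (List.length_take_le _ _)]

/-- If `L` can be placed to the right of `X` and below `K`, then `T`, `K`, `X` and `L` form a
tableau with `T` in its upper-left corner. -/
theorem IsRect.exists_quilt {a b : ℕ} {T X Y : Tableau} (hT : T.IsRect a b) (hX : Smaller T X)
    (hY : Smaller T Y) (hXL : FixesCols b (X.left b) (Y.below a)) :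
    ∃ W : Tableau, W.HasCorner a b T ∧ W.below a = X.left b * Y.below a ∧
      (W.top a).right b = Y.top a := by
  set Z := X.left b * Y.below a with hZ
  have hZl : Z.left b = X.left b := by rw [hXL.1, left_left le_rfl]
  have hZr : Z.right b = Y.below a := by rw [hXL.2, right_left_self, empty_mul']
  let f : ℕ → List ℤ := fun i => if i < a then T.row i ++ Y.row i else Z.row (i - a)
  have hf₁ : ∀ i, i < a → f i = T.row i ++ Y.row i := fun i hi => if_pos hi
  have hf₂ : ∀ i, f (a + i) = Z.row i := fun i => by
    simp [f]
  have hs : ∀ i, (f i).Pairwise (· ≤ ·) := fun i => by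
    rcases lt_or_ge i a with hi | hi
    · rw [hf₁ i hi, List.pairwise_append]
      exact ⟨T.row_sorted i, Y.row_sorted i, hY.row_le i⟩
    · obtain ⟨k, rfl⟩ := Nat.exists_eq_add_of_le hi
      rw [hf₂]
      exact Z.row_sorted k
  have ha : ∀ i, Above (f i) (f (i + 1)) := fun i => by
    rcases lt_or_ge (i + 1) a with hi | hi
    · rw [hf₁ i (by omega), hf₁ (i + 1) hi]
      refine (T.row_above i).append (Y.row_above i) (.inl ?_)
      rw [hT.length_row, hT.length_row, if_pos hi, if_pos (by omega)]
    · rcases lt_or_ge i a with hi' | hi'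
      -- The seam below the rectangle: the first b entries come from X and exceed T, while the
      -- others continue row a - 1 of Y by its row a.
      · obtain rfl : a = i + 1 := by omega
        have h₀ := hf₂ 0
        rw [add_zero] at h₀
        rw [h₀, hf₁ i hi', ← List.take_append_drop b (Z.row 0)]
        have hTi : (T.row i).length = b := by rw [hT.length_row, if_pos hi']
        refine Above.append (above_of_forall_lt ?_ ?_) ?_ ?_
        · rw [hTi]
          exact List.length_take_le _ _
        · intro x hx y hy
          rw [← row_left, hZl] at hy
          exact hX x (hasEntry_iff_row.2 ⟨i, hx⟩) y
            (hasEntry_of_left (hasEntry_iff_row.2 ⟨0, hy⟩))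
        · rw [← row_right, hZr, row_below]
          exact Y.row_above i
        · rw [List.drop_eq_nil_iff, List.length_take, hTi]
          omega
      · obtain ⟨k, rfl⟩ := Nat.exists_eq_add_of_le hi'
        rw [add_assoc, hf₂, hf₂]
        exact Z.row_above k
  have hm : ∀ i, a + Z.rows.length ≤ i → f i = [] := fun i hi => by
    obtain ⟨k, rfl⟩ := Nat.exists_eq_add_of_le (show a ≤ i by omega)
    rw [hf₂]
    exact Tableau.row_eq_nil (by omega)
  have hW := row_ofRows hs ha hm
  have hTi : ∀ i < a, (T.row i).length = b := fun i hi => by rw [hT.length_row, if_pos hi]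
  refine ⟨ofRows f (a + Z.rows.length) hs ha, ⟨fun i hi => ?_, ?_⟩, ?_, ?_⟩
  · change b ≤ ((ofRows f (a + Z.rows.length) hs ha).row i).length
    rw [hW, hf₁ i hi, List.length_append, hTi i hi]
    omega
  · refine row_ext fun i => ?_
    rw [row_left, row_top, hW]
    split_ifs with hi
    · rw [hf₁ i hi, List.take_left' (hTi i hi)]
    · rw [hT.row_eq_nil (not_lt.1 hi), List.take_nil]
  · exact row_ext fun i => by rw [row_below, hW, hf₂]
  · refine row_ext fun i => ?_
    rw [row_right, row_top, row_top, hW]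
    split_ifs with hi
    · rw [hf₁ i hi, List.drop_left' (hTi i hi)]
    · exact List.drop_nil

theorem Smaller.of_hasEntry {T X X' : Tableau} (h : Smaller T X)
    (h' : ∀ x, X'.HasEntry x → X.HasEntry x) : Smaller T X' :=
  fun t ht x hx => h t ht x (h' x hx)

/-- The product `X * T * Y` contains `T` in its corner, and every such factorization leads to the
simple one with everything below `T` in the first factor. -/
theorem IsRect.reaches {a b : ℕ} {T : Tableau} (hT : T.IsRect a b) {X Y : Tableau}
    (hX : Smaller T X) (hY : Smaller T Y) :
    (X * T * Y).HasCorner a b T ∧ Relation.ReflTransGen (Models a b T) (X, Y)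
      ((X * T * Y).below a, ((X * T * Y).top a).right b) := by
  -- The measure is the number of boxes of X and Y outside the first b columns of X; the total
  -- number of boxes never changes.
  obtain ⟨m, hm⟩ : ∃ m, X.word.length + Y.word.length ≤ m + (X.left b).word.length :=
    ⟨X.word.length + Y.word.length, by omega⟩
  induction m using Nat.strong_induction_on generalizing X Y with
  | _ m ih =>
    set Y₁ := X.right b * Y with hY₁
    have hX₀ : Smaller T (X.left b) := hX.of_hasEntry fun _ => hasEntry_of_left
    have hs₁ : Smaller T Y₁ := (hX.of_hasEntry fun _ => hasEntry_of_right).mul hY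
    have hL : Smaller T (Y₁.below a) := hs₁.of_hasEntry fun _ => hasEntry_of_below
    have hK : Smaller T (Y₁.top a) := hs₁.of_hasEntry fun _ => hasEntry_of_top
    -- Both steps use an extreme factorization: first all of `X.right b` goes to the right, then all
    -- of `Y₁.below a` goes to the left.
    have hstep₁ : Models a b T (X, Y) (X.left b, Y₁) :=
      ⟨fun t ht => ⟨hX t ht, hY t ht⟩, .inl ⟨∅, X.right b, (empty_mul' _).symm, rfl, rfl⟩⟩
    have hstep₂ : Models a b T (X.left b, Y₁) (X.left b * Y₁.below a, Y₁.top a) :=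
      ⟨fun t ht => ⟨hX₀ t ht, hs₁ t ht⟩,
        .inr ⟨Y₁.below a, ∅, rfl, rfl, (empty_mul' _).symm⟩⟩
    have heq : X * T * Y = X.left b * Y₁.below a * T * Y₁.top a := by
      rw [hT.mul_eq' hX, mul_assoc (X.left b * T), ← hY₁, mul_assoc (X.left b), hT.mul_eq hs₁]
      simp only [mul_assoc]
    have hsteps := (Relation.ReflTransGen.single hstep₁).tail hstep₂
    rcases fixesCols_or_lt b (X.left b) (Y₁.below a) with h | h
    · obtain ⟨W, hW, hWb, hWt⟩ := hT.exists_quilt hX hs₁ h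
      have hWeq : X * T * Y = W := by
        rw [heq, ← hWb, ← hWt, mul_assoc]
        conv_rhs => rw [← below_mul_top a W, ← left_mul_right b (W.top a)]
        rw [← hW.2]
      rw [hWeq, hWb, hWt]
      exact ⟨hW, hsteps⟩
    · have h₁ := length_word_mul (X.left b) (X.right b)
      have h₂ := length_word_mul (Y₁.below a) (Y₁.top a)
      have h₃ := length_word_mul (X.right b) Y
      have h₄ := length_word_mul (X.left b) (Y₁.below a)
      rw [left_mul_right] at h₁
      rw [← hY₁] at h₃
      rw [below_mul_top] at h₂
      rw [left_left le_rfl] at h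
      have := ih (m - 1) (by
        have := length_word_mul ((X.left b * Y₁.below a).left b) ((X.left b * Y₁.below a).right b)
        rw [left_mul_right] at this
        omega) (hX₀.mul hL) hK (by omega)
      rw [← heq] at this
      exact ⟨this.1, hsteps.trans this.2⟩

end Tableau
end FactorSeq

namespace FactorSeq
open Step

/-! ### Labeled paths -/

/-- The displacement of a step. -/
def Step.vec : Step → ℕ × ℕ
  | down => (0, 1)
  | up => (1, 0)
  | horiz => (1, 1)

@[simp] theorem endpoint_nil : endpoint [] = 0 := rfl

@[simp] theorem endpoint_cons (s : Step) (γ : List Step) :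
    endpoint (s :: γ) = s.vec + endpoint γ := by
  cases s <;> simp [endpoint, Step.vec] <;> omega

@[simp] theorem endpoint_append (γ δ : List Step) :
    endpoint (γ ++ δ) = endpoint γ + endpoint δ := by
  induction γ with
  | nil => simp
  | cons s γ ih => simp [ih, add_assoc]

theorem forall_prefix_append {p : List Step → Prop} {γ δ : List Step} :
    (∀ ε, ε <+: γ ++ δ → p ε) ↔ (∀ ε, ε <+: γ → p ε) ∧ ∀ ε, ε <+: δ → p (γ ++ ε) := by
  constructor
  · exact fun h => ⟨fun ε hε => h ε (hε.trans (List.prefix_append _ _)),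
      fun ε hε => h _ ((List.prefix_append_right_inj γ).2 hε)⟩
  · rintro ⟨h₁, h₂⟩ ε hε
    rcases List.prefix_or_prefix_of_prefix hε (List.prefix_append γ δ) with h | ⟨c, rfl⟩
    · exact h₁ ε h
    · exact h₂ c ((List.prefix_append_right_inj γ).1 hε)

theorem forall_prefix_cons {p : List Step → Prop} {s : Step} {δ : List Step} :
    (∀ ε, ε <+: s :: δ → p ε) ↔ p [] ∧ ∀ ε, ε <+: δ → p (s :: ε) := by
  constructor
  · exact fun h => ⟨h _ List.nil_prefix, fun ε hε => h _ (List.cons_prefix_cons.2 ⟨rfl, hε⟩)⟩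
  · rintro ⟨h₁, h₂⟩ ε hε
    cases ε with
    | nil => exact h₁
    | cons t ε =>
      obtain ⟨rfl, h⟩ := List.cons_prefix_cons.1 hε
      exact h₂ ε h

theorem IsPath.horiz_of_down_up {n : ℕ} {α β : List Step} (h : IsPath n (α ++ down :: up :: β)) :
    IsPath n (α ++ horiz :: β) := by
  obtain ⟨h₁, h₂⟩ := h
  simp only [forall_prefix_append, forall_prefix_cons, endpoint_append, endpoint_cons, Step.vec,
    ← add_assoc, endpoint_nil, add_zero] at h₁ h₂
  refine ⟨?_, ?_⟩
  · simp only [endpoint_append, endpoint_cons, Step.vec, ← add_assoc]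
    simpa [add_assoc] using h₁
  · simp only [forall_prefix_append, forall_prefix_cons, endpoint_append, endpoint_cons, Step.vec,
      ← add_assoc, endpoint_nil, add_zero]
    exact ⟨h₂.1, h₂.2.1, by simpa [add_assoc] using h₂.2.2.2⟩

theorem IsPath.down_up_of_horiz {n : ℕ} {α β : List Step} (h : IsPath n (α ++ horiz :: β)) :
    IsPath n (α ++ down :: up :: β) := by
  obtain ⟨h₁, h₂⟩ := h
  simp only [forall_prefix_append, forall_prefix_cons, endpoint_append, endpoint_cons, Step.vec,
    ← add_assoc, endpoint_nil, add_zero] at h₁ h₂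
  refine ⟨?_, ?_⟩
  · simp only [endpoint_append, endpoint_cons, Step.vec, ← add_assoc]
    simpa [add_assoc] using h₁
  · simp only [forall_prefix_append, forall_prefix_cons, endpoint_append, endpoint_cons, Step.vec,
      ← add_assoc, endpoint_nil, add_zero]
    have := h₂.2.1
    refine ⟨h₂.1, h₂.2.1, ?_, by simpa [add_assoc] using h₂.2.2⟩
    simp only [Prod.fst_add, Prod.snd_add]
    omega

theorem IsPath.horiz_of_up_down {n : ℕ} {α β : List Step} (h : IsPath n (α ++ up :: down :: β)) :
    IsPath n (α ++ horiz :: β) := by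
  obtain ⟨h₁, h₂⟩ := h
  simp only [forall_prefix_append, forall_prefix_cons, endpoint_append, endpoint_cons, Step.vec,
    ← add_assoc, endpoint_nil, add_zero] at h₁ h₂
  refine ⟨?_, ?_⟩
  · simp only [endpoint_append, endpoint_cons, Step.vec, ← add_assoc]
    simpa [add_assoc] using h₁
  · simp only [forall_prefix_append, forall_prefix_cons, endpoint_append, endpoint_cons, Step.vec,
      ← add_assoc, endpoint_nil, add_zero]
    exact ⟨h₂.1, h₂.2.1, by simpa [add_assoc] using h₂.2.2.2⟩

theorem isPath_lowest (n : ℕ) : IsPath n (List.replicate n down ++ List.replicate n up) := by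
  constructor
  · simp [endpoint, List.count_replicate]
  · rw [forall_prefix_append]
    constructor
    · intro ε hε
      rw [List.prefix_replicate_iff] at hε
      rw [hε.2]
      simp [endpoint, List.count_replicate]
    · intro ε hε
      rw [List.prefix_replicate_iff] at hε
      rw [hε.2]
      simpa [endpoint, List.count_replicate] using hε.1

/-- The steps of a labeled path. -/
def steps (l : List (Step × Tableau)) : List Step := l.map Prod.fst

@[simp] theorem steps_nil : steps [] = [] := rfl

@[simp] theorem steps_cons (x : Step × Tableau) (l : List (Step × Tableau)) :
    steps (x :: l) = x.1 :: steps l := rfl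

@[simp] theorem steps_append (l m : List (Step × Tableau)) :
    steps (l ++ m) = steps l ++ steps m := List.map_append

/-- The point reached by a labeled path. -/
def point (l : List (Step × Tableau)) : ℕ × ℕ := endpoint (steps l)

@[simp] theorem point_nil : point [] = 0 := rfl

@[simp] theorem point_cons (x : Step × Tableau) (l : List (Step × Tableau)) :
    point (x :: l) = x.1.vec + point l := by simp [point]

@[simp] theorem point_append (l m : List (Step × Tableau)) :
    point (l ++ m) = point l + point m := by simp [point]

theorem point_up_down (l m : List (Step × Tableau)) (P Q W : Tableau) :
    point (l ++ (up, P) :: (down, Q) :: m) = point (l ++ (horiz, W) :: m) := by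
  rw [point_append, point_append, point_cons, point_cons, point_cons, ← add_assoc (Step.vec _)]
  rfl

theorem point_down_up (l m : List (Step × Tableau)) (P Q W : Tableau) :
    point (l ++ (down, Q) :: (up, P) :: m) = point (l ++ (horiz, W) :: m) := by
  rw [point_append, point_append, point_cons, point_cons, point_cons, ← add_assoc (Step.vec _)]
  rfl

variable {n : ℕ} {R : RectDiagram n}

/-- The tableau in the triangle below a horizontal step that starts at the point `p`. -/
def TableauDiagram.at (𝒯 : TableauDiagram R) (p : ℕ × ℕ) : Tableau := 𝒯.T p.1 (p.2 + 1)

/-- Paths labeled by a factor sequence. -/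
inductive IsLabeled (𝒯 : TableauDiagram R) : List (Step × Tableau) → Prop
  | lowest : IsLabeled 𝒯 (List.replicate n (down, ∅) ++ List.replicate n (up, ∅))
  | split {l m : List (Step × Tableau)} {P Q : Tableau}
      (hp : IsPath n (steps (l ++ (up, P) :: (down, Q) :: m)))
      (h : IsLabeled 𝒯 (l ++ (horiz, P * Q) :: m)) :
      IsLabeled 𝒯 (l ++ (up, P) :: (down, Q) :: m)
  | merge {l m : List (Step × Tableau)} {Q P : Tableau}
      (h : IsLabeled 𝒯 (l ++ (down, Q) :: (up, P) :: m)) :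
      IsLabeled 𝒯 (l ++ (horiz, Q * 𝒯.at (point l) * P) :: m)

variable {𝒯 : TableauDiagram R}

theorem IsLabeled.isPath {l : List (Step × Tableau)} (h : IsLabeled 𝒯 l) : IsPath n (steps l) := by
  induction h with
  | lowest => simpa [steps] using isPath_lowest n
  | split hp _ _ => exact hp
  | merge _ ih => simpa using IsPath.horiz_of_down_up (by simpa using ih)

theorem IsFactorSeq.isLabeled {γ : List Step} {L : List Tableau} (h : IsFactorSeq 𝒯 γ L) :
    γ.length = L.length ∧ IsLabeled 𝒯 (γ.zip L) := by
  induction h with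
  | lowest =>
    refine ⟨by simp; omega, ?_⟩
    have : List.replicate (2 * n) (∅ : Tableau) = List.replicate n ∅ ++ List.replicate n ∅ := by
      rw [← List.replicate_add, two_mul]
    rw [this, List.zip_append (by simp), List.zip_replicate', List.zip_replicate']
    exact .lowest
  | @case1 α γ γ' A B P Q hγ hA _ ih =>
    obtain ⟨β, rfl, rfl⟩ := hγ.exists_rest
    have hp := hγ.isPath
    simp only [List.append_assoc, List.cons_append, List.nil_append, List.length_append,
      List.length_cons] at ih hp ⊢
    rw [List.zip_append hA.symm] at ih ⊢
    have hl : β.length = B.length := by omega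
    refine ⟨by omega, IsLabeled.split (m := β.zip B) ?_ (by simpa using ih.2)⟩
    change IsPath n (List.map Prod.fst (α.zip A ++ (up, P) :: (down, Q) :: β.zip B))
    simpa [List.map_fst_zip, hA.ge, hl.le] using hp
  | @case2 α γ γ' i j A B Q P hγ hA _ ih =>
    obtain ⟨β, rfl, rfl⟩ := hγ.exists_rest
    simp only [List.append_assoc, List.cons_append, List.nil_append, List.length_append,
      List.length_cons] at ih ⊢
    rw [List.zip_append hA.symm] at ih ⊢
    refine ⟨by omega, ?_⟩
    have hm := IsLabeled.merge (by simpa using ih.2)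
    have hT : 𝒯.at (point (α.zip A)) = 𝒯.T i j := by
      have hs : steps (α.zip A) = α := List.map_fst_zip hA.ge
      rw [point, hs, hγ.start, TableauDiagram.at]
      congr 1
      exact Nat.sub_add_cancel hγ.pos
    rw [hT] at hm
    simpa using hm

theorem IsLabeled.isFactorSeq {l : List (Step × Tableau)} (h : IsLabeled 𝒯 l) :
    IsFactorSeq 𝒯 (steps l) (l.map Prod.snd) := by
  induction h with
  | lowest =>
    have : List.replicate (2 * n) (∅ : Tableau) = List.replicate n ∅ ++ List.replicate n ∅ := by
      rw [← List.replicate_add, two_mul]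
    simpa [steps, this] using IsFactorSeq.lowest (𝒯 := 𝒯)
  | @split l m P Q hp h ih =>
    have hp' := h.isPath
    have := IsFactorSeq.case1 (α := steps l) (γ := steps (l ++ (up, P) :: (down, Q) :: m))
      (A := l.map Prod.snd) (B := m.map Prod.snd) P Q
      ⟨hp, hp', steps m, by simp, by simp⟩ (by simp [steps]) (by simpa using ih)
    simpa using this
  | @merge l m Q P h ih =>
    have hp := h.isPath
    have := IsFactorSeq.case2 (α := steps l) (i := (point l).1) (j := (point l).2 + 1)
      (γ := steps (l ++ (horiz, Q * 𝒯.at (point l) * P) :: m))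
      (A := l.map Prod.snd) (B := m.map Prod.snd) Q P
      ⟨(IsLabeled.merge h).isPath, hp, ⟨steps m, by simp, by simp⟩, rfl, by omega⟩
      (by simp [steps]) (by simpa using ih)
    simpa [TableauDiagram.at] using this

/-! ### Inversion of the two rules -/

theorem not_up_down_lowest {l m : List (Step × Tableau)} {P Q : Tableau} :
    List.replicate n (down, ∅) ++ List.replicate n (up, ∅) ≠ l ++ (up, P) :: (down, Q) :: m := by
  intro h
  have hp : (List.replicate n ((down, ∅) : Step × Tableau) ++
      List.replicate n (up, ∅)).Pairwise fun x y : Step × Tableau => ¬ (x.1 = up ∧ y.1 = down) := by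
    rw [List.pairwise_append]
    refine ⟨List.pairwise_replicate.2 (by simp), List.pairwise_replicate.2 (by simp), ?_⟩
    intro x hx y hy
    rw [List.eq_of_mem_replicate hx]
    simp
  rw [h, List.pairwise_append] at hp
  have := (List.pairwise_cons.1 hp.2.1).1 (down, Q) (by simp)
  simp at this

theorem not_horiz_lowest {l m : List (Step × Tableau)} {W : Tableau} :
    List.replicate n (down, ∅) ++ List.replicate n (up, ∅) ≠ l ++ (horiz, W) :: m := by
  intro h
  have : (horiz, W) ∈ List.replicate n ((down, ∅) : Step × Tableau) ++
      List.replicate n (up, ∅) := by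
    rw [h]
    simp
  rcases List.mem_append.1 this with h | h <;> simpa using List.eq_of_mem_replicate h

/-- If the last rule applied created this very pair, its premise is the claim. Otherwise it acted on
disjoint steps and can be applied after the replacement instead. -/
theorem IsLabeled.up_down_inv {l m : List (Step × Tableau)} {P Q : Tableau}
    (h : IsLabeled 𝒯 (l ++ (up, P) :: (down, Q) :: m)) :
    IsLabeled 𝒯 (l ++ (horiz, P * Q) :: m) := by
  generalize hk : l ++ (up, P) :: (down, Q) :: m = k at h
  induction h generalizing l m with
  | lowest => exact absurd hk.symm not_up_down_lowest
  | @split l' m' P' Q' hp h ih =>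
    have hp' : IsPath n (steps (l ++ (up, P) :: (down, Q) :: m)) := hk ▸ hp
    have hpath : IsPath n (steps (l ++ (horiz, P * Q) :: m)) := by
      simpa using IsPath.horiz_of_up_down (by simpa using hp')
    rcases List.append_eq_append_iff.1 hk with ⟨c, rfl, hc⟩ | ⟨c, rfl, hc⟩
    · rcases c with _ | ⟨x, _ | ⟨y, c⟩⟩
      · simp only [List.nil_append, List.cons.injEq, Prod.mk.injEq, true_and] at hc
        obtain ⟨rfl, rfl, rfl⟩ := hc
        simpa using h
      · simp at hc
      · simp only [List.cons_append, List.cons.injEq] at hc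
        obtain ⟨rfl, rfl, rfl⟩ := hc
        have := ih (l := l) (m := c ++ (horiz, P' * Q') :: m') (by simp)
        simpa using IsLabeled.split (l := l ++ (horiz, P * Q) :: c) (by simpa using hpath)
          (by simpa using this)
    · rcases c with _ | ⟨x, _ | ⟨y, c⟩⟩
      · simp only [List.nil_append, List.cons.injEq, Prod.mk.injEq, true_and] at hc
        obtain ⟨rfl, rfl, rfl⟩ := hc
        simpa using h
      · simp at hc
      · simp only [List.cons_append, List.cons.injEq] at hc
        obtain ⟨rfl, rfl, rfl⟩ := hc
        have := ih (l := l' ++ (horiz, P' * Q') :: c) (m := m) (by simp)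
        simpa using IsLabeled.split (l := l') (m := c ++ (horiz, P * Q) :: m) (by simpa using hpath)
          (by simpa using this)
  | @merge l' m' Q' P' h ih =>
    rcases List.append_eq_append_iff.1 hk with ⟨c, rfl, hc⟩ | ⟨c, rfl, hc⟩
    · rcases c with _ | ⟨x, _ | ⟨y, c⟩⟩
      · simp at hc
      · simp at hc
      · simp only [List.cons_append, List.cons.injEq] at hc
        obtain ⟨rfl, rfl, rfl⟩ := hc
        have := ih (l := l) (m := c ++ (down, Q') :: (up, P') :: m') (by simp)
        have := IsLabeled.merge (l := l ++ (horiz, P * Q) :: c) (by simpa using this)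
        -- The tableau inserted by the later merge depends on its starting point, which the
        -- replacement does not move.
        rw [← point_up_down l c P Q] at this
        simpa using this
    · rcases c with _ | ⟨x, c⟩
      · simp at hc
      · simp only [List.cons_append, List.cons.injEq] at hc
        obtain ⟨rfl, rfl⟩ := hc
        have := ih (l := l' ++ (down, Q') :: (up, P') :: c) (m := m) (by simp)
        simpa using IsLabeled.merge (l := l') (m := c ++ (horiz, P * Q) :: m) (by simpa using this)

/-- The lowest path has no horizontal step, so this one was created by a merge, and all rules
applied afterwards act elsewhere and commute with it. Only some factorization is obtained; passing
to every simple one is the real content of part 1. -/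
theorem IsLabeled.horiz_inv {l m : List (Step × Tableau)} {W : Tableau}
    (h : IsLabeled 𝒯 (l ++ (horiz, W) :: m)) :
    ∃ Q P, W = Q * 𝒯.at (point l) * P ∧ IsLabeled 𝒯 (l ++ (down, Q) :: (up, P) :: m) := by
  generalize hk : l ++ (horiz, W) :: m = k at h
  induction h generalizing l m with
  | lowest => exact absurd hk.symm not_horiz_lowest
  | @split l' m' P' Q' hp h ih =>
    have hp' : IsPath n (steps (l ++ (horiz, W) :: m)) := hk ▸ hp
    have hpath : IsPath n (steps l ++ down :: up :: steps m) :=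
      IsPath.down_up_of_horiz (by simpa using hp')
    rcases List.append_eq_append_iff.1 hk with ⟨c, rfl, hc⟩ | ⟨c, rfl, hc⟩
    · rcases c with _ | ⟨x, c⟩
      · simp at hc
      · simp only [List.cons_append, List.cons.injEq] at hc
        obtain ⟨rfl, rfl⟩ := hc
        obtain ⟨Q, P, hW, this⟩ := ih (l := l) (m := c ++ (horiz, P' * Q') :: m') (by simp)
        refine ⟨Q, P, hW, ?_⟩
        simpa using IsLabeled.split (l := l ++ (down, Q) :: (up, P) :: c) (by simpa using hpath)
          (by simpa using this)
    · rcases c with _ | ⟨x, _ | ⟨y, c⟩⟩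
      · simp at hc
      · simp at hc
      · simp only [List.cons_append, List.cons.injEq] at hc
        obtain ⟨rfl, rfl, rfl⟩ := hc
        obtain ⟨Q, P, hW, this⟩ := ih (l := l' ++ (horiz, P' * Q') :: c) (m := m) (by simp)
        refine ⟨Q, P, ?_, ?_⟩
        · rwa [point_up_down l' c P' Q' (P' * Q')]
        · simpa using IsLabeled.split (l := l') (m := c ++ (down, Q) :: (up, P) :: m)
            (by simpa using hpath) (by simpa using this)
  | @merge l' m' Q' P' h ih =>
    rcases List.append_eq_append_iff.1 hk with ⟨c, rfl, hc⟩ | ⟨c, rfl, hc⟩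
    · rcases c with _ | ⟨x, c⟩
      · simp only [List.nil_append, List.cons.injEq, Prod.mk.injEq, true_and] at hc
        obtain ⟨rfl, rfl⟩ := hc
        exact ⟨Q', P', by simp, by simpa using h⟩
      · simp only [List.cons_append, List.cons.injEq] at hc
        obtain ⟨rfl, rfl⟩ := hc
        obtain ⟨Q, P, hW, this⟩ := ih (l := l) (m := c ++ (down, Q') :: (up, P') :: m') (by simp)
        refine ⟨Q, P, hW, ?_⟩
        have := IsLabeled.merge (l := l ++ (down, Q) :: (up, P) :: c) (by simpa using this)
        rw [point_down_up l c P Q W] at this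
        simpa using this
    · rcases c with _ | ⟨x, c⟩
      · simp only [List.nil_append, List.cons.injEq, Prod.mk.injEq, true_and] at hc
        obtain ⟨rfl, rfl⟩ := hc
        exact ⟨Q', P', by simp, by simpa using h⟩
      · simp only [List.cons_append, List.cons.injEq] at hc
        obtain ⟨rfl, rfl⟩ := hc
        obtain ⟨Q, P, hW, this⟩ := ih (l := l' ++ (down, Q') :: (up, P') :: c) (m := m) (by simp)
        refine ⟨Q, P, ?_, ?_⟩
        · rwa [point_down_up] at hW
        · simpa using IsLabeled.merge (l := l') (m := c ++ (down, Q) :: (up, P) :: m)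
            (by simpa using this)

end FactorSeq

namespace FactorSeq
open Step Tableau

variable {n : ℕ} {R : RectDiagram n} {𝒯 : TableauDiagram R}

/-! ### The entries of a factor sequence -/

/-- The entries of `X` are entries of rectangles `(k, l)` to the lower left and lower right of a
step `s` that starts at `p`. -/
def EntriesBelow (𝒯 : TableauDiagram R) (p : ℕ × ℕ) (s : Step) (X : Tableau) : Prop :=
  ∀ x, X.HasEntry x → ∃ k l, (𝒯.T k l).HasEntry x ∧ l ≤ n ∧ p.2 < l ∧
    (k < p.1 ∨ (s ≠ down ∧ k = p.1))

/-- All labels of a path that starts at `p` satisfy `EntriesBelow`. -/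
def LabelsBelow (𝒯 : TableauDiagram R) : ℕ × ℕ → List (Step × Tableau) → Prop
  | _, [] => True
  | p, x :: l => EntriesBelow 𝒯 p x.1 x.2 ∧ LabelsBelow 𝒯 (p + x.1.vec) l

theorem labelsBelow_append {p : ℕ × ℕ} {l m : List (Step × Tableau)} :
    LabelsBelow 𝒯 p (l ++ m) ↔ LabelsBelow 𝒯 p l ∧ LabelsBelow 𝒯 (p + point l) m := by
  induction l generalizing p with
  | nil => simp [LabelsBelow]
  | cons x l ih => simp [LabelsBelow, ih, and_assoc, add_assoc]

theorem not_hasEntry_empty (x : ℤ) : ¬ (∅ : Tableau).HasEntry x := by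
  rintro ⟨r, hr, -⟩
  simp [rows_empty] at hr

theorem labelsBelow_replicate (p : ℕ × ℕ) (s : Step) (k : ℕ) :
    LabelsBelow 𝒯 p (List.replicate k (s, ∅)) := by
  induction k generalizing p with
  | zero => trivial
  | succ k ih => exact ⟨fun x hx => absurd hx (not_hasEntry_empty x), ih _⟩

theorem IsLabeled.point_le {l m : List (Step × Tableau)} (h : IsLabeled 𝒯 (l ++ m)) :
    (point l).1 ≤ (point l).2 :=
  h.isPath.2 (steps l) (by simp)

theorem IsLabeled.point_add {l m : List (Step × Tableau)} (h : IsLabeled 𝒯 (l ++ m)) :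
    point l + point m = (n, n) := by
  rw [← point_append]
  exact h.isPath.1

theorem IsLabeled.labelsBelow {l : List (Step × Tableau)} (h : IsLabeled 𝒯 l) :
    LabelsBelow 𝒯 0 l := by
  induction h with
  | lowest => exact labelsBelow_append.2 ⟨labelsBelow_replicate _ _ _, labelsBelow_replicate _ _ _⟩
  | @split l m P Q hp h ih =>
    rw [labelsBelow_append] at ih ⊢
    refine ⟨ih.1, fun x hx => ?_, fun x hx => ?_, ?_⟩
    · obtain ⟨k, l, h₁, h₂, h₃, h₄⟩ := ih.2.1 x (hasEntry_mul.2 (.inl hx))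
      exact ⟨k, l, h₁, h₂, h₃, by simpa using h₄⟩
    · obtain ⟨k, l, h₁, h₂, h₃, h₄⟩ := ih.2.1 x (hasEntry_mul.2 (.inr hx))
      refine ⟨k, l, h₁, h₂, ?_, .inl ?_⟩
      · simpa [Step.vec] using h₃
      · simp only [Step.vec, zero_add, Prod.fst_add] at h₄ ⊢
        omega
    · have := ih.2.2
      rwa [add_assoc]
  | @merge l m Q P h ih =>
    rw [labelsBelow_append] at ih ⊢
    refine ⟨ih.1, fun x hx => ?_, ?_⟩
    · simp only [hasEntry_mul] at hx
      rcases hx with (hx | hx) | hx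
      · obtain ⟨k, l, h₁, h₂, h₃, h₄⟩ := ih.2.1 x hx
        exact ⟨k, l, h₁, h₂, h₃, by simp at h₄ ⊢; omega⟩
      · refine ⟨_, _, hx, ?_, ?_, .inr ⟨by simp, ?_⟩⟩
        · have := congrArg Prod.snd h.point_add
          simp [Step.vec] at this
          omega
        · simp
        · simp
      · obtain ⟨k, l, h₁, h₂, h₃, h₄⟩ := ih.2.2.1 x hx
        refine ⟨k, l, h₁, h₂, ?_, ?_⟩
        · simp [Step.vec] at h₃ ⊢
          omega
        · simpa [Step.vec] using h₄
    · have := ih.2.2.2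
      rwa [add_assoc] at this

theorem IsLabeled.entriesBelow {l m : List (Step × Tableau)} {s : Step} {X : Tableau}
    (h : IsLabeled 𝒯 (l ++ (s, X) :: m)) : EntriesBelow 𝒯 (point l) s X := by
  have := (labelsBelow_append.1 h.labelsBelow).2.1
  rwa [zero_add] at this

/-- Entries of the two labels come from tableaux `T k l'` whose index interval strictly contains
that of the triangle, so the order condition of the diagram applies. -/
theorem IsLabeled.smaller {l m : List (Step × Tableau)} {X Y : Tableau}
    (h : IsLabeled 𝒯 (l ++ (down, X) :: (up, Y) :: m)) :
    Smaller (𝒯.at (point l)) X ∧ Smaller (𝒯.at (point l)) Y := by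
  have hle := h.point_le
  constructor
  · intro t ht x hx
    obtain ⟨k, l', h₁, h₂, h₃, h₄⟩ := h.entriesBelow x hx
    simp only [ne_eq, not_true_eq_false, false_and, or_false] at h₄
    exact 𝒯.entry_lt k l' _ _ (by omega) (by omega) (by omega) h₂
      (by rw [Ne, Prod.mk.injEq]; omega) t x ht h₁
  · intro t ht x hx
    have h' : IsLabeled 𝒯 ((l ++ [(down, X)]) ++ (up, Y) :: m) := by simpa using h
    obtain ⟨k, l', h₁, h₂, h₃, h₄⟩ := h'.entriesBelow x hx
    simp [Step.vec] at h₃ h₄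
    exact 𝒯.entry_lt k l' _ _ (by omega) (by omega) (by omega) h₂
      (by rw [Ne, Prod.mk.injEq]; omega) t x ht h₁

theorem IsLabeled.eq_empty_of_fst_eq_zero {l m : List (Step × Tableau)} {X : Tableau}
    (h : IsLabeled 𝒯 (l ++ (down, X) :: m)) (hl : (point l).1 = 0) : X = ∅ := by
  refine eq_empty_of_forall_not_hasEntry fun x hx => ?_
  obtain ⟨k, l', -, -, -, h₄⟩ := h.entriesBelow x hx
  simp [hl] at h₄

theorem IsLabeled.eq_empty_of_snd_eq {l m : List (Step × Tableau)} {s : Step} {X : Tableau}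
    (h : IsLabeled 𝒯 (l ++ (s, X) :: m)) (hl : (point l).2 = n) : X = ∅ := by
  refine eq_empty_of_forall_not_hasEntry fun x hx => ?_
  obtain ⟨k, l', -, h₂, h₃, -⟩ := h.entriesBelow x hx
  omega

/-! ### Moving factors past a vertex -/

theorem point_congr {l l' : List (Step × Tableau)} (h : steps l' = steps l) :
    point l' = point l := by rw [point, h, point]

/-- A path that does not just go up after `l` can be lowered until it goes down after `l`. -/
theorem IsLabeled.expose_down : ∀ {m l : List (Step × Tableau)} {s : Step} {V : Tableau},
    (s ≠ up ∨ ∃ t ∈ m, t.1 ≠ up) → IsLabeled 𝒯 (l ++ (s, V) :: m) →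
    ∃ X m', IsLabeled 𝒯 (l ++ (down, X) :: m') ∧ ∀ l' N, steps l' = steps l →
      IsLabeled 𝒯 (l' ++ (down, N * X) :: m') → IsLabeled 𝒯 (l' ++ (s, N * V) :: m)
  | m, l, down, V, _, h => ⟨V, m, h, fun _ _ _ h => h⟩
  | m, l, horiz, V, _, h => by
    obtain ⟨Q, P, rfl, h'⟩ := h.horiz_inv
    refine ⟨Q, (up, P) :: m, h', fun l' N hl h => ?_⟩
    have := h.merge
    rwa [point_congr hl, mul_assoc N, mul_assoc N] at this
  | [], _, up, _, hs, _ => by simp at hs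
  | (t, V') :: m, l, up, V, hs, h => by
    obtain ⟨X', m', h₁, h₂⟩ := IsLabeled.expose_down (l := l ++ [(up, V)]) (s := t) (V := V')
      (m := m) (by simpa using hs) (by simpa using h)
    simp only [List.append_assoc, List.cons_append, List.nil_append] at h₁
    -- Once the following step goes down, the up-down pair collapses to a horizontal step, which in
    -- turn opens into down-up.
    obtain ⟨Q, P, hQP, h₃⟩ := h₁.up_down_inv.horiz_inv
    refine ⟨Q, (up, P) :: m', h₃, fun l' N hl h' => ?_⟩
    have h₄ := h'.merge
    rw [point_congr hl, mul_assoc N, mul_assoc N, ← hQP, ← mul_assoc] at h₄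
    have h₅ := IsLabeled.split (by simpa [hl] using h₁.isPath) h₄
    -- The extra factor has been absorbed in the label of the up step; the empty factor restores the
    -- original remainder `m`.
    have := h₂ (l' ++ [(up, N * V)]) ∅ (by simp [hl]) (by simpa using h₅)
    simpa using this

/-- A path that does not just go down before `m` can be lowered until it goes up before `m`. -/
theorem IsLabeled.expose_up {l m : List (Step × Tableau)} {s : Step} {V : Tableau}
    (hs : s ≠ down ∨ ∃ t ∈ l, t.1 ≠ down) (h : IsLabeled 𝒯 (l ++ (s, V) :: m)) :
    ∃ X l', point l' + (1, 0) = point l + s.vec ∧ IsLabeled 𝒯 (l' ++ (up, X) :: m) ∧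
      ∀ m' N, steps m' = steps m →
      IsLabeled 𝒯 (l' ++ (up, X * N) :: m') → IsLabeled 𝒯 (l ++ (s, V * N) :: m') := by
  induction l using List.reverseRecOn generalizing s V m with
  | nil =>
    cases s with
    | down => simp at hs
    | up => exact ⟨V, [], rfl, h, fun _ _ _ h => h⟩
    | horiz =>
      obtain ⟨Q, P, rfl, h'⟩ := h.horiz_inv
      refine ⟨P, [(down, Q)], by simp [Step.vec], h', fun m' N hm h => ?_⟩
      have := IsLabeled.merge (l := []) h
      rwa [← mul_assoc] at this
  | append_singleton l x ih =>
    obtain ⟨t, V'⟩ := x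
    cases s with
    | up => exact ⟨V, _, rfl, h, fun _ _ _ h => h⟩
    | horiz =>
      obtain ⟨Q, P, rfl, h'⟩ := h.horiz_inv
      refine ⟨P, l ++ [(t, V'), (down, Q)], ?_, by simpa using h', fun m' N hm h => ?_⟩
      · simp [Step.vec, add_assoc]
      have := IsLabeled.merge (l := l ++ [(t, V')]) (Q := Q) (P := P * N) (m := m')
        (by simpa using h)
      rwa [← mul_assoc] at this
    | down =>
      obtain ⟨X', l', hp, h₁, h₂⟩ := ih (s := t) (V := V') (m := (down, V) :: m)
        (by simpa [or_comm] using hs) (by simpa using h)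
      obtain ⟨Q, P, hQP, h₃⟩ := h₁.up_down_inv.horiz_inv
      refine ⟨P, l' ++ [(down, Q)], ?_, by simpa using h₃, fun m' N hm h' => ?_⟩
      · simp only [point_append, point_cons, point_nil, add_zero, ← hp, add_assoc]
        rfl
      have h₄ := IsLabeled.merge (l := l') (Q := Q) (P := P * N) (m := m') (by simpa using h')
      rw [← mul_assoc, ← hQP, mul_assoc] at h₄
      have h₅ := IsLabeled.split (by simpa [hm] using h₁.isPath) h₄
      have := h₂ ((down, V * N) :: m') ∅ (by simp [hm]) (by simpa using h₅)
      simpa using this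

theorem point_snd_of_forall_up : ∀ {m : List (Step × Tableau)}, (∀ t ∈ m, t.1 = up) →
    (point m).2 = 0
  | [], _ => rfl
  | (s, X) :: m, h => by
    have hs : s = up := h (s, X) (by simp)
    have := point_snd_of_forall_up (m := m) fun t ht => h t (by simp [ht])
    simp [hs, Step.vec, this]

theorem point_fst_of_forall_down : ∀ {m : List (Step × Tableau)}, (∀ t ∈ m, t.1 = down) →
    (point m).1 = 0
  | [], _ => rfl
  | (s, X) :: m, h => by
    have hs : s = down := h (s, X) (by simp)
    have := point_fst_of_forall_down (m := m) fun t ht => h t (by simp [ht])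
    simp [hs, Step.vec, this]

/-- Any right factor of the label of an up step can be moved to the next step. -/
theorem IsLabeled.move_right_of_up {l m : List (Step × Tableau)} {s : Step} {Y N V : Tableau}
    (h : IsLabeled 𝒯 (l ++ (up, Y * N) :: (s, V) :: m)) :
    IsLabeled 𝒯 (l ++ (up, Y) :: (s, N * V) :: m) := by
  by_cases hs : s ≠ up ∨ ∃ t ∈ m, t.1 ≠ up
  · obtain ⟨X, m', h₁, h₂⟩ := IsLabeled.expose_down (l := l ++ [(up, Y * N)]) hs (by simpa using h)
    -- The labels of an up-down pair are an arbitrary splitting of their product, so the product may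
    -- be bracketed differently.
    have h₃ : IsLabeled 𝒯 (l ++ (up, Y) :: (down, N * X) :: m') := by
      refine .split ?_ ?_
      · simpa using h₁.isPath
      · have := IsLabeled.up_down_inv (by simpa using h₁)
        rwa [mul_assoc] at this
    simpa using h₂ (l ++ [(up, Y)]) N (by simp) (by simpa using h₃)
  · push Not at hs
    have h0 : (point ((up, Y * N) :: (s, V) :: m)).2 = 0 := point_snd_of_forall_up (by
      intro t ht
      simp only [List.mem_cons] at ht
      rcases ht with rfl | rfl | ht
      · rfl
      · exact hs.1
      · exact hs.2 t ht)
    have hpt := congrArg Prod.snd h.point_add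
    rw [Prod.snd_add, h0] at hpt
    -- A path that only goes up from here lies on the lower right border, where all labels are
    -- empty.
    obtain ⟨rfl, rfl⟩ := mul_eq_empty (h.eq_empty_of_snd_eq hpt)
    simpa using h

/-- Any left factor of the label of a down step can be moved to the previous step. -/
theorem IsLabeled.move_left_of_down {l m : List (Step × Tableau)} {s : Step} {V N Y : Tableau}
    (h : IsLabeled 𝒯 (l ++ (s, V) :: (down, N * Y) :: m)) :
    IsLabeled 𝒯 (l ++ (s, V * N) :: (down, Y) :: m) := by
  by_cases hs : s ≠ down ∨ ∃ t ∈ l, t.1 ≠ down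
  · obtain ⟨X, l', -, h₁, h₂⟩ := IsLabeled.expose_up hs h
    refine h₂ ((down, Y) :: m) N (by simp) (.split ?_ ?_)
    · simpa using h₁.isPath
    · have := h₁.up_down_inv
      rwa [← mul_assoc] at this
  · push Not at hs
    have h0 : (point (l ++ [(s, V)])).1 = 0 := point_fst_of_forall_down (by
      intro t ht
      rcases List.mem_append.1 ht with ht | ht
      · exact hs.2 t ht
      · rw [List.mem_singleton.1 ht]
        exact hs.1)
    have h' : IsLabeled 𝒯 ((l ++ [(s, V)]) ++ (down, N * Y) :: m) := by simpa using h
    obtain ⟨rfl, rfl⟩ := mul_eq_empty (h'.eq_empty_of_fst_eq_zero h0)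
    simpa using h

/-- Every horizontal step that starts at `p` may be replaced according to any simple
factorization of its label. -/
def SimpleFactorizationsLift (𝒯 : TableauDiagram R) (p : ℕ × ℕ) : Prop :=
  ∀ l m W, point l = p → IsLabeled 𝒯 (l ++ (horiz, W) :: m) →
    W.HasCorner (R.numRows p.1 (p.2 + 1)) (R.numCols p.1 (p.2 + 1)) (𝒯.at p) ∧
    ∀ Q P, IsSimpleFactorization (R.numRows p.1 (p.2 + 1)) (R.numCols p.1 (p.2 + 1))
      W Q (𝒯.at p) P → IsLabeled 𝒯 (l ++ (down, Q) :: (up, P) :: m)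

/-- Opening the horizontal step by a suitable simple factorization puts N at the right end of an
up-going label, from where it can pass on; closing the step again leaves U. -/
theorem IsLabeled.move_right_of_horiz {l m : List (Step × Tableau)} {s : Step} {U N V : Tableau}
    {b : ℕ} (h : IsLabeled 𝒯 (l ++ (horiz, U * N) :: (s, V) :: m))
    (hS : SimpleFactorizationsLift 𝒯 (point l))
    (hb : R.numCols (point l).1 ((point l).2 + 1) ≤ b) (hU : FixesCols b U N) :
    IsLabeled 𝒯 (l ++ (horiz, U) :: (s, N * V) :: m) := by
  obtain ⟨hc, hS⟩ := hS l _ _ rfl h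
  set b' := R.numCols (point l).1 ((point l).2 + 1)
  set a' := R.numRows (point l).1 ((point l).2 + 1)
  have hU := hU.mono hb
  have hleft : ((U * N).below a').left b' * 𝒯.at (point l) = (U * N).left b' := by
    rw [hc.2, below_left, top_left, below_mul_top]
  have hsimple : IsSimpleFactorization a' b' (U * N) (((U * N).below a').left b') (𝒯.at (point l))
      ((U * N).right b') := by
    -- All of Z goes to the up step, so that its label is everything to the right of column b',
    -- which is `U.right b'` times N.
    refine ⟨hc, by rw [hleft, left_mul_right], ∅, ((U * N).below a').right b',
      (empty_mul' _).symm, rfl, ?_⟩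
    rw [below_right, top_right, below_mul_top]
  have h₁ := hS _ _ hsimple
  rw [hU.2] at h₁
  have h₂ := IsLabeled.move_right_of_up (l := l ++ [(down, ((U * N).below a').left b')])
    (by simpa using h₁)
  have h₃ := IsLabeled.merge (l := l) (by simpa using h₂)
  rwa [hleft, hU.1, left_mul_right] at h₃

theorem IsLabeled.move_left_of_horiz {l m : List (Step × Tableau)} {s : Step} {V M W : Tableau}
    {a : ℕ} {p : ℕ × ℕ} (h : IsLabeled 𝒯 (l ++ (s, V) :: (horiz, M * W) :: m))
    (hp : point l + s.vec = p) (hS : SimpleFactorizationsLift 𝒯 p)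
    (ha : R.numRows p.1 (p.2 + 1) ≤ a) (hW : FixesRows a M W) :
    IsLabeled 𝒯 (l ++ (s, V * M) :: (horiz, W) :: m) := by
  obtain ⟨hc, hS⟩ := hS (l ++ [(s, V)]) _ _ (by simpa using hp) (by simpa using h)
  set b' := R.numCols p.1 (p.2 + 1)
  set a' := R.numRows p.1 (p.2 + 1)
  have hW := hW.mono ha
  have htop : 𝒯.at p * ((M * W).top a').right b' = (M * W).top a' := by
    rw [hc.2, left_mul_right]
  have hsimple : IsSimpleFactorization a' b' (M * W) ((M * W).below a') (𝒯.at p)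
      (((M * W).top a').right b') := by
    refine ⟨hc, by rw [mul_assoc, htop, below_mul_top], ((M * W).below a').right b', ∅,
      rfl, ?_, (empty_mul' _).symm⟩
    rw [left_mul_right]
  have h₁ := hS _ _ hsimple
  rw [hW.2] at h₁
  have h₂ := IsLabeled.move_left_of_down (by simpa using h₁)
  have h₃ := IsLabeled.merge (l := l ++ [(s, V * M)]) (by simpa using h₂)
  have hp' : point (l ++ [(s, V * M)]) = p := by simpa using hp
  rw [hp', mul_assoc, htop, hW.1, below_mul_top] at h₃
  simpa using h₃

/-- The step before the down step is lowered until it goes up, say with label Z; the pair then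
becomes a horizontal step labeled Z·X·N over the neighboring triangle to the left. Its rectangle is
no wider, and N still fixes the relevant columns of Z·X. On the left border the label is empty. -/
theorem IsLabeled.move_right_of_down {l m : List (Step × Tableau)} {s : Step} {X N V : Tableau}
    (h : IsLabeled 𝒯 (l ++ (down, X * N) :: (s, V) :: m))
    (hS : ∀ i, (point l).1 = i + 1 → SimpleFactorizationsLift 𝒯 (i, (point l).2))
    (hX : FixesCols (R.numCols (point l).1 ((point l).2 + 1)) X N) :
    IsLabeled 𝒯 (l ++ (down, X) :: (s, N * V) :: m) := by
  have hle := h.point_le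
  have hlen : (point l).2 + 1 ≤ n := by
    have := congrArg Prod.snd h.point_add
    simp [Step.vec] at this
    omega
  by_cases hl : ∃ t ∈ l, t.1 ≠ down
  · obtain ⟨l₀, ⟨t, V'⟩, rfl⟩ := (List.eq_nil_or_concat' l).resolve_left (by
      rintro rfl
      simp at hl)
    obtain ⟨Z, l', hp, h₁, h₂⟩ := IsLabeled.expose_up (l := l₀) (s := t) (V := V')
      (by simpa [or_comm] using hl) (by simpa using h)
    have hp' : point (l₀ ++ [(t, V')]) = point l' + (1, 0) := by simpa using hp.symm
    rw [hp'] at hX hS hle hlen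
    have h₃ := h₁.up_down_inv
    rw [← mul_assoc] at h₃
    have h₄ := h₃.move_right_of_horiz (hS _ rfl) (R.numCols_le _ _ (by simpa using hle) (by
      simpa using hlen)) (hX.mul_left Z)
    have h₅ := IsLabeled.split (by simpa using h₁.isPath) h₄
    have := h₂ ((down, X) :: (s, N * V) :: m) ∅ (by simp) (by simpa using h₅)
    simpa using this
  · push Not at hl
    obtain ⟨rfl, rfl⟩ := mul_eq_empty (h.eq_empty_of_fst_eq_zero (point_fst_of_forall_down hl))
    simpa using h

/-- Dual to `IsLabeled.move_right_of_down`: the neighboring triangle is now the one to the right,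
whose rectangle has no more rows. -/
theorem IsLabeled.move_left_of_up {l m : List (Step × Tableau)} {s : Step} {V M Y : Tableau}
    {p : ℕ × ℕ} (h : IsLabeled 𝒯 (l ++ (s, V) :: (up, M * Y) :: m)) (hp : point l + s.vec = p)
    (hlt : p.1 < p.2) (hS : p.2 < n → SimpleFactorizationsLift 𝒯 p)
    (hY : FixesRows (R.numRows p.1 p.2) M Y) :
    IsLabeled 𝒯 (l ++ (s, V * M) :: (up, Y) :: m) := by
  have hpl : point (l ++ [(s, V)]) = p := by simpa using hp
  have h' : IsLabeled 𝒯 ((l ++ [(s, V)]) ++ (up, M * Y) :: m) := by simpa using h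
  by_cases hm : ∃ t ∈ m, t.1 ≠ up
  · obtain ⟨⟨t, V'⟩, m₀, rfl⟩ := List.exists_cons_of_ne_nil (l := m) (by
      rintro rfl
      simp at hm)
    obtain ⟨Z, m', h₁, h₂⟩ := IsLabeled.expose_down (l := l ++ [(s, V), (up, M * Y)]) (s := t)
      (V := V') (m := m₀) (by simpa using hm) (by simpa using h)
    have h₃ := IsLabeled.up_down_inv (l := l ++ [(s, V)]) (by simpa using h₁)
    have hlen : p.2 + 1 ≤ n := by
      have := congrArg Prod.snd h₃.point_add
      rw [hpl] at this
      simp [Step.vec] at this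
      omega
    rw [mul_assoc] at h₃
    have h₄ := IsLabeled.move_left_of_horiz (by simpa using h₃) hp (hS hlen)
      (R.numRows_le _ _ hlt hlen) (hY.mul_right Z)
    have h₅ := IsLabeled.split (l := l ++ [(s, V * M)]) (P := Y) (Q := Z) (m := m')
      (by simpa using h₁.isPath) (by simpa using h₄)
    have := h₂ (l ++ [(s, V * M), (up, Y)]) ∅ (by simp) (by simpa using h₅)
    simpa using this
  · push Not at hm
    have h0 : (point ((up, M * Y) :: m)).2 = 0 := point_snd_of_forall_up (by simpa using hm)
    have hpt := congrArg Prod.snd h'.point_add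
    rw [Prod.snd_add, h0] at hpt
    obtain ⟨rfl, rfl⟩ := mul_eq_empty (h'.eq_empty_of_snd_eq hpt)
    simpa using h

/-! ### The criterion for factor sequences -/

theorem IsLabeled.models {l m : List (Step × Tableau)} {X Y X' Y' : Tableau}
    (h : IsLabeled 𝒯 (l ++ (down, X) :: (up, Y) :: m))
    (hS₁ : ∀ i, (point l).1 = i + 1 → SimpleFactorizationsLift 𝒯 (i, (point l).2))
    (hS₂ : (point l).2 + 1 < n → SimpleFactorizationsLift 𝒯 ((point l).1, (point l).2 + 1))
    (hM : Models (R.numRows (point l).1 ((point l).2 + 1))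
      (R.numCols (point l).1 ((point l).2 + 1)) (𝒯.at (point l)) (X, Y) (X', Y')) :
    IsLabeled 𝒯 (l ++ (down, X') :: (up, Y') :: m) := by
  have hle := h.point_le
  rcases hM.2 with ⟨M, N, hMN, hX', hY'⟩ | ⟨M, N, hMN, hX', hY'⟩
  · dsimp only at hMN hX' hY'
    subst hX' hY'
    refine IsLabeled.move_right_of_down ?_ hS₁ (fixesCols_of_right_eq hMN)
    rwa [mul_assoc, ← hMN, left_mul_right]
  · dsimp only at hMN hX' hY'
    subst hX' hY'
    refine IsLabeled.move_left_of_up (p := ((point l).1, (point l).2 + 1)) ?_ rfl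
      (Nat.lt_succ_of_le hle) hS₂ (fixesRows_of_below_eq hMN)
    rwa [← mul_assoc, ← hMN, below_mul_top]

/-- The vertex of a triangle is also an end of the horizontal sides of the two triangles next below
it, and moving factors at the vertex needs the claim only for these. Hence the induction runs from
the bottom of the diagram upwards, along `p.1 + (n - p.2)`. -/
theorem simpleFactorizationsLift (𝒯 : TableauDiagram R) (p : ℕ × ℕ) :
    SimpleFactorizationsLift 𝒯 p := by
  obtain ⟨k, hk⟩ : ∃ k, p.1 + (n - p.2) = k := ⟨_, rfl⟩
  induction k using Nat.strong_induction_on generalizing p with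
  | _ k ih =>
    rintro l m W rfl h
    have hle := h.point_le
    obtain ⟨X, Y, rfl, hXY⟩ := h.horiz_inv
    have hlen : (point l).2 + 1 ≤ n := by
      have := congrArg Prod.snd h.point_add
      simp [Step.vec] at this
      omega
    obtain ⟨hX, hY⟩ := hXY.smaller
    have hT : (𝒯.at (point l)).IsRect (R.numRows (point l).1 ((point l).2 + 1))
        (R.numCols (point l).1 ((point l).2 + 1)) :=
      𝒯.isRect _ _ (Nat.lt_succ_of_le hle) hlen
    obtain ⟨hc, hr⟩ := hT.reaches hX hY
    refine ⟨hc, fun Q P hQP => ?_⟩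
    have hstep : ∀ {X Y X' Y'}, IsLabeled 𝒯 (l ++ (down, X) :: (up, Y) :: m) → _ →
        IsLabeled 𝒯 (l ++ (down, X') :: (up, Y') :: m) := fun {X Y X' Y'} h hM =>
      h.models (X := X) (Y := Y) (X' := X') (Y' := Y')
        (fun i hi => ih _ (by simp only; omega) _ rfl)
        (fun hlt => ih _ (by simp only; omega) _ rfl) hM
    have hreach : ∀ q, Relation.ReflTransGen (Models (R.numRows (point l).1 ((point l).2 + 1))
        (R.numCols (point l).1 ((point l).2 + 1)) (𝒯.at (point l))) (X, Y) q →
        IsLabeled 𝒯 (l ++ (down, q.1) :: (up, q.2) :: m) := by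
      intro q hq
      induction hq with
      | refl => exact hXY
      | tail _ hM ih => exact hstep ih hM
    have hbase := hreach _ hr
    obtain ⟨Q', P', hZ, rfl, rfl⟩ := hQP.exists_factor
    obtain ⟨hX', hY'⟩ := hbase.smaller
    -- From the extreme pair, with all of Z on the left, a given simple factorization differs by one
    -- ⊨ step that splits Z as prescribed.
    exact hstep hbase ⟨fun t ht => ⟨hX' t ht, hY' t ht⟩, .inl ⟨Q', P', hZ, rfl, rfl⟩⟩

theorem IsLabeled.leads {l m : List (Step × Tableau)} {q q' : Tableau × Tableau}
    (h : IsLabeled 𝒯 (l ++ (down, q.1) :: (up, q.2) :: m))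
    (hL : Leads (R.numRows (point l).1 ((point l).2 + 1))
      (R.numCols (point l).1 ((point l).2 + 1)) (𝒯.at (point l)) q q') :
    IsLabeled 𝒯 (l ++ (down, q'.1) :: (up, q'.2) :: m) := by
  have hstep : ∀ {q q' : Tableau × Tableau}, IsLabeled 𝒯 (l ++ (down, q.1) :: (up, q.2) :: m) →
      _ → IsLabeled 𝒯 (l ++ (down, q'.1) :: (up, q'.2) :: m) := fun h hM =>
    h.models (fun _ _ => simpleFactorizationsLift 𝒯 _) (fun _ => simpleFactorizationsLift 𝒯 _) hM
  induction hL with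
  | single hM => exact hstep h hM
  | tail _ hM ih => exact hstep ih hM

end FactorSeq

/-! ### The theorem, carried over from labeled paths to factor sequences -/

open FactorSeq in
theorem mainTheorem4 {n : ℕ} (R : RectDiagram n) (𝒯 : TableauDiagram R)
    (α γ γ' : List Step) (i j : ℕ) (hγ : IsCase2 n α i j γ γ')
    (A B : List Tableau) (hA : A.length = α.length) :
    (∀ W : Tableau, IsFactorSeq 𝒯 γ (A ++ [W] ++ B) →
      W.HasCorner (R.numRows i j) (R.numCols i j) (𝒯.T i j) ∧
      ∀ Q P : Tableau,
        IsSimpleFactorization (R.numRows i j) (R.numCols i j) W Q (𝒯.T i j) P →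
        IsFactorSeq 𝒯 γ' (A ++ [Q, P] ++ B)) ∧
    (∀ X Y X' Y' : Tableau, IsFactorSeq 𝒯 γ' (A ++ [X, Y] ++ B) →
      Leads (R.numRows i j) (R.numCols i j) (𝒯.T i j) (X, Y) (X', Y') →
      IsFactorSeq 𝒯 γ' (A ++ [X', Y'] ++ B)) := by
  obtain ⟨β, rfl, rfl⟩ := hγ.exists_rest
  -- The triangle is named by its bottom vertex `(i, j)`, whereas labeled paths use the starting
  -- point `(i, q)` of the horizontal side.
  obtain ⟨q, rfl⟩ : ∃ q, j = q + 1 := ⟨j - 1, (Nat.sub_add_cancel hγ.pos).symm⟩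
  have hs : steps (α.zip A) = α := List.map_fst_zip hA.ge
  have hp : point (α.zip A) = (i, q) := by rw [point, hs, hγ.start, Nat.add_sub_cancel]
  have hout : ∀ Q P, β.length = B.length →
      IsLabeled 𝒯 (α.zip A ++ (Step.down, Q) :: (Step.up, P) :: β.zip B) →
      IsFactorSeq 𝒯 (α ++ [Step.down, Step.up] ++ β) (A ++ [Q, P] ++ B) := by
    intro Q P hl h
    have hsβ : steps (β.zip B) = β := List.map_fst_zip hl.le
    simpa [hs, hsβ, List.map_snd_zip, hA.le, hl.ge] using h.isFactorSeq
  refine ⟨fun W hW => ?_, fun X Y X' Y' hXY hL => ?_⟩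
  · obtain ⟨hlen, hW⟩ := hW.isLabeled
    rw [List.append_assoc, List.append_assoc, List.zip_append hA.symm] at hW
    have hl : β.length = B.length := by
      simp only [List.length_append, List.length_cons, List.length_nil] at hlen
      omega
    obtain ⟨h₁, h₂⟩ := simpleFactorizationsLift 𝒯 (i, q) _ (β.zip B) W hp (by simpa using hW)
    exact ⟨h₁, fun Q P hQP => hout Q P hl (h₂ Q P hQP)⟩
  · obtain ⟨hlen, hXY⟩ := hXY.isLabeled
    rw [List.append_assoc, List.append_assoc, List.zip_append hA.symm] at hXY
    have hl : β.length = B.length := by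
      simp only [List.length_append, List.length_cons, List.length_nil] at hlen
      omega
    refine hout X' Y' hl (IsLabeled.leads (q := (X, Y)) (q' := (X', Y')) (by simpa using hXY) ?_)
    rw [hp]
    exact hL
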